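/- **Setting.** Let $d\in\mathbb N$, let $X\subset\mathbb R$, let $\mu$ be a probability measure on $X$, and let $\Omega=X^{\mathbb Z^d}$ with the product $\sigma$-algebra, $\mathbb P=\bigotimes_{k\in\mathbb Z^d}\mu$ and the shifts $(S_j\omega)_k=\omega_{k+j}$. Let $\mathcal H=\ell^2(\mathbb Z^d)$ with canonical basis $(\varphi_j)_{j\in\mathbb Z^d}$, and let $V_j$ be the unitary operator with $V_j\varphi_k=\varphi_{k-j}$. Let $\gamma_1,\dots,\gamma_d\in\mathbb Z^d$ be linearly independent, let $\Gamma$ be the lattice they generate, and let $B=\{\sum_i x_i\gamma_i:0\le x_i<1\}\cap\mathbb Z^d$ be its primitive cell. A contraction $T$ is *completely non unitary* (cnu) if $x=0$ is the only vector with $\|T^nx\|=\|x\|=\|T^{*n}x\|$ for all $n\in\mathbb N$. Write $\mathbb D$ for the open unit disk and $\mathbb T$ for the unit circle. For a cnu contraction $T$ and $f(z)=\sum_n c_nz^n$ in $H^\infty(\mathbb D)$ put $f(T)=\operatorname{s-lim}_{\rho\to1^-}\sum_n c_n\rho^nT^n$, and let $f(e^{it})=\lim_{\rho\to1^-}f(\rho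 e^{it})$ be the boundary values of $f$. For $n\in\mathbb N$ let $\Lambda=\Lambda_n=\bigcup_{-n\le n_1,\dots,n_d\le n}\bigl(B+\sum_i n_i\gamma_i\bigr)$ and $\mathcal H_\Lambda=\operatorname{span}\{\varphi_j:j\in\Lambda\}$, and let $P_\Lambda$ be the orthogonal projection onto $\mathcal H_\Lambda$. Let $\|\cdot\|_1$ be the trace norm and $\operatorname{spr}$ the spectral radius. **Assumptions.** 1. $(T_\omega)_{\omega\in\Omega}$ is a family of cnu contractions on $\mathcal H$ such that $\omega\mapsto\langle x\,|\,T_\omega y\rangle$ is measurable for all $x,y\in\mathcal H$. 2. $T_{S_g\omega}=V_gT_\omega V_g^{-1}$ for all $g\in\Gamma$ and $\omega\in\Omega$. 3. For all $n$ and $\omega$ there are given a cnu contraction $T^\Lambda_\omega$ on $\mathcal H_\Lambda$ and a bounded operator $T^{\Lambda^C}_\omega$ on $\mathcal H_\Lambda^\perp$ such that $T_\omega-T_\omega^\Lambda\oplus T_\omega^{\Lambda^C}$ is of trace class. For every $\omega$, $$\bigl\|P_\Lambda\bigl(T_\omega-T_\omega^\Lambda\oplus T_\omega^{\Lambda^C}\bigr)\bigr\|_1=o(|\Lambda|)\quad\text{as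 } n\to\infty .$$ 4. There is $r$ with $0\le r<1$ and $\operatorname{spr}(T^\Lambda_\omega)\le r$ for all $\Lambda=\Lambda_n$ and all $\omega\in\Omega$. Let $$L(f)=\frac1{|B|}\sum_{b\in B}\mathbb E\bigl(\langle\varphi_b\,|\,f(T_\omega)\varphi_b\rangle\bigr),\qquad f\in H^\infty(\mathbb D),$$ be the density of states functional. **Theorem.** There is a function $\psi$, holomorphic on the disk $\mathbb D/r=\{z\in\mathbb C: r|z|<1\}$ (which is $\mathbb C$ if $r=0$), such that $\varphi(e^{it})=\overline{\psi(e^{it})}$ represents $L$: $\varphi\in L^1(\mathbb T)$, $\varphi$ is not a boundary function of an element of $H^1_0(\mathbb D)=\{g\in H^1(\mathbb D):g(0)=0\}$, and for all $f\in H^\infty(\mathbb D)$ $$L(f)=\int_{\mathbb T}f(e^{it})\,\overline{\psi(e^{it})}\,\frac{dt}{2\pi}.$$ -/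

import Mathlib

open MeasureTheory Filter Topology
open scoped ENNReal ComplexConjugate

namespace DOS

noncomputable section

/-! ### The lattice, the Hilbert space and the translations -/

/-- The lattice `ℤ^d`. -/
abbrev Site (d : ℕ) : Type := Fin d → ℤ

/-- The Hilbert space `ℓ²(ℤ^d)`. -/
abbrev Hilb (d : ℕ) : Type := lp (fun _ : Site d => ℂ) 2

/-- The canonical basis vector `φ_j`. -/
def basisVec {d : ℕ} (j : Site d) : Hilb d := lp.single 2 j (1 : ℂ)

/-- The configuration space `Ω = X^{ℤ^d}` for `X ⊆ ℝ`. -/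
abbrev Config (d : ℕ) (X : Set ℝ) : Type := Site d → X

/-- The shift `(S_j ω)_k = ω_{k+j}`. -/
def shift {d : ℕ} {X : Set ℝ} (j : Site d) (ω : Config d X) : Config d X := fun k => ω (k + j)

theorem memlp_translate {d : ℕ} (j : Site d) (x : Hilb d) :
    Memℓp (fun k : Site d => x (k + j)) 2 := by
  have h := lp.memℓp x
  rw [memℓp_gen_iff (by norm_num)] at h ⊢
  exact h.comp_injective (add_left_injective j)

/-- The unitary translation `V_j`, given by `(V_j x)_k = x_{k+j}`, so that `V_j φ_k = φ_{k-j}`. -/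
def translate {d : ℕ} (j : Site d) : Hilb d ≃ₗᵢ[ℂ] Hilb d where
  toFun x := ⟨fun k => x (k + j), memlp_translate j x⟩
  invFun x := ⟨fun k => x (k + -j), memlp_translate (-j) x⟩
  map_add' _ _ := rfl
  map_smul' _ _ := rfl
  left_inv x := by ext k; simp
  right_inv x := by ext k; simp
  norm_map' x := by
    rw [lp.norm_eq_tsum_rpow (by norm_num), lp.norm_eq_tsum_rpow (by norm_num)]
    congr 1
    exact (Equiv.addRight j).tsum_eq (fun k => ‖x k‖ ^ (2 : ℝ≥0∞).toReal)

theorem translate_basisVec {d : ℕ} (j k : Site d) :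
    translate j (basisVec k) = basisVec (k - j) := by
  ext m
  change (basisVec k : Hilb d) (m + j) = (basisVec (k - j) : Hilb d) m
  simp only [basisVec, lp.single_apply, Pi.single_apply, eq_sub_iff_add_eq]

/-! ### The periodic lattice, its primitive cell and the boxes -/

/-- The primitive cell `{∑ x_i γ_i : 0 ≤ x_i < 1} ∩ ℤ^d`. -/
def cellSet {d : ℕ} (γ : Fin d → Site d) : Set (Site d) :=
  {j | ∃ x : Fin d → ℝ, (∀ i, 0 ≤ x i ∧ x i < 1) ∧ ∀ k, (j k : ℝ) = ∑ i, x i * (γ i k : ℝ)}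

theorem cellSet_finite {d : ℕ} (γ : Fin d → Site d) : (cellSet γ).Finite := by
  refine (Set.finite_Icc (fun k => -∑ i, |γ i k|) (fun k => ∑ i, |γ i k|)).subset ?_
  rintro j ⟨x, hx, hj⟩
  have key : ∀ k, |j k| ≤ ∑ i, |γ i k| := by
    intro k
    have : |(j k : ℝ)| ≤ ∑ i, |(γ i k : ℝ)| := by
      rw [hj k]
      refine (Finset.abs_sum_le_sum_abs _ _).trans (Finset.sum_le_sum fun i _ => ?_)
      rw [abs_mul, abs_of_nonneg (hx i).1]
      exact mul_le_of_le_one_left (abs_nonneg _) (hx i).2.le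
    exact_mod_cast this
  exact ⟨fun k => (abs_le.1 (key k)).1, fun k => (abs_le.1 (key k)).2⟩

/-- The primitive cell `B` as a finite set. -/
def cell {d : ℕ} (γ : Fin d → Site d) : Finset (Site d) := (cellSet_finite γ).toFinset

/-- The box `Λ_n`: the union of the translates `B + ∑ n_i γ_i` with `-n ≤ n_i ≤ n`. -/
def box {d : ℕ} (γ : Fin d → Site d) (n : ℕ) : Finset (Site d) :=
  (Fintype.piFinset fun _ : Fin d => Finset.Icc (-(n : ℤ)) (n : ℤ)).biUnion
    fun m => (cell γ).image fun b => b + ∑ i, m i • γ i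

/-! ### Finite volume subspaces -/

open Classical in
/-- The finite dimensional subspace `ℋ_Λ = span {φ_j : j ∈ Λ}`. -/
def volSpace {d : ℕ} (Λ : Finset (Site d)) : Submodule ℂ (Hilb d) :=
  Submodule.span ℂ ((Λ.image basisVec : Finset (Hilb d)) : Set (Hilb d))

instance {d : ℕ} (Λ : Finset (Site d)) : FiniteDimensional ℂ (volSpace Λ) := by
  unfold volSpace; infer_instance

instance {d : ℕ} (Λ : Finset (Site d)) : CompleteSpace (volSpace Λ) :=
  FiniteDimensional.complete ℂ _

/-- The direct sum `A ⊕ C` of operators on `K` and `Kᗮ`, as an operator on the whole space. -/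
def directSum {d : ℕ} (K : Submodule ℂ (Hilb d)) [K.HasOrthogonalProjection]
    (A : K →L[ℂ] K) (C : Kᗮ →L[ℂ] Kᗮ) : Hilb d →L[ℂ] Hilb d :=
  K.subtypeL ∘L A ∘L K.orthogonalProjectionOnto +
    Kᗮ.subtypeL ∘L C ∘L Kᗮ.orthogonalProjectionOnto

/-! ### Contractions, trace norm, functional calculus -/

/-- `T` is a completely non unitary contraction: `‖T‖ ≤ 1`, and the subspace
`{x : ‖T^n x‖ = ‖x‖ = ‖T*^n x‖ for all n}` carrying the unitary part is trivial. -/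
def IsCNUContraction {H : Type*} [NormedAddCommGroup H] [InnerProductSpace ℂ H] [CompleteSpace H]
    (T : H →L[ℂ] H) : Prop :=
  ‖T‖ ≤ 1 ∧
    ∀ x : H, (∀ n : ℕ, ‖(T ^ n) x‖ = ‖x‖ ∧ ‖(ContinuousLinearMap.adjoint T ^ n) x‖ = ‖x‖) → x = 0

/-- The absolute value `|A| = (A* A)^{1/2}` of a bounded operator. -/
def opAbs {H : Type*} [NormedAddCommGroup H] [InnerProductSpace ℂ H] [CompleteSpace H]
    (A : H →L[ℂ] H) : H →L[ℂ] H := CFC.abs A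

/-- The trace norm `‖A‖₁ = tr |A|`, with value `∞` if `A` is not of trace class. -/
def traceNorm {d : ℕ} (A : Hilb d →L[ℂ] Hilb d) : ℝ≥0∞ :=
  ∑' j : Site d, ENNReal.ofReal (inner ℂ (basisVec j) (opAbs A (basisVec j))).re

/-- `f` belongs to `H^∞(𝔻)`: it is holomorphic and bounded on the open unit disk. Only the
restriction of `f` to the disk matters. -/
def IsHInfty (f : ℂ → ℂ) : Prop :=
  DifferentiableOn ℂ f (Metric.ball 0 1) ∧ ∃ C : ℝ, ∀ z ∈ Metric.ball (0 : ℂ) 1, ‖f z‖ ≤ C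

/-- The boundary value `f(e^{it}) = lim_{ρ → 1⁻} f(ρ e^{it})`. -/
def boundaryValue (f : ℂ → ℂ) (t : ℝ) : ℂ :=
  limUnder (𝓝[<] (1 : ℝ)) fun ρ : ℝ => f (ρ * Complex.exp (t * Complex.I))

/-- `f_ρ(T) = ∑ c_n ρ^n T^n`, where `f(z) = ∑ c_n z^n` on the unit disk. -/
def dilatedCalc {H : Type*} [NormedAddCommGroup H] [NormedSpace ℂ H]
    (f : ℂ → ℂ) (ρ : ℝ) (T : H →L[ℂ] H) : H →L[ℂ] H :=
  ∑' n : ℕ, (iteratedDeriv n f 0 / (n.factorial : ℂ) * (ρ : ℂ) ^ n) • T ^ n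

open Classical in
/-- The functional calculus `f(T) = s-lim_{ρ → 1⁻} f_ρ(T)`. The limit exists when `T` is a
completely non unitary contraction and `f ∈ H^∞(𝔻)`; the value is `0` if it does not exist. -/
def hInftyCalc {H : Type*} [NormedAddCommGroup H] [NormedSpace ℂ H]
    (f : ℂ → ℂ) (T : H →L[ℂ] H) : H →L[ℂ] H :=
  if h : ∃ A : H →L[ℂ] H, ∀ x : H,
      Tendsto (fun ρ : ℝ => dilatedCalc f ρ T x) (𝓝[<] (1 : ℝ)) (𝓝 (A x))
  then h.choose else 0

/-! ### The density of states functional -/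

/-- The product probability measure `ℙ = ⨂_{k ∈ ℤ^d} μ` on `X^{ℤ^d}`. -/
abbrev prodMeasure (d : ℕ) {X : Set ℝ} (μ : Measure X) [IsProbabilityMeasure μ] :
    Measure (Config d X) :=
  Measure.infinitePi fun _ : Site d => μ

/-- `L(f) = |B|⁻¹ ∑_{b ∈ B} 𝔼 ⟨φ_b, f(T_ω) φ_b⟩`. -/
def dosFunctional {d : ℕ} {X : Set ℝ} (γ : Fin d → Site d) (μ : Measure X)
    [IsProbabilityMeasure μ] (T : Config d X → (Hilb d →L[ℂ] Hilb d)) (f : ℂ → ℂ) : ℂ :=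
  ((cell γ).card : ℂ)⁻¹ *
    ∑ b ∈ cell γ, ∫ ω, inner ℂ (basisVec b) (hInftyCalc f (T ω) (basisVec b)) ∂(prodMeasure d μ)

/-- `φ ∈ L¹(𝕋)`, as a function of the angle `t`. -/
def IsL1Circle (φ : ℝ → ℂ) : Prop := IntervalIntegrable φ volume 0 (2 * Real.pi)

/-- `φ` is the boundary function of an element of `H¹₀(𝔻) = {g ∈ H¹(𝔻) : g(0) = 0}`. Here
`H¹(𝔻)` is identified with the functions in `L¹(𝕋)` whose negative Fourier coefficients vanish,
and `g(0)` is the Fourier coefficient of index `0`. -/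
def IsH10Circle (φ : ℝ → ℂ) : Prop :=
  IsL1Circle φ ∧
    ∀ k : ℕ, ∫ t in (0 : ℝ)..(2 * Real.pi), Complex.exp (k * t * Complex.I) * φ t = 0

end

end DOS

namespace DOS

/-! ### Absolutely convergent power series on the unit circle -/

/-! Everything rests on the moments `m_k = L(z^k)` and the bound `|m_k| ≤ r^k`. Covariance and the
shift invariance of the product measure make `m_k` the expectation of `|Λ|⁻¹ ∑_{j∈Λ} ⟨φ_j, T^k φ_j⟩`
for every box `Λ` (`dosMoment_eq_integral`). Telescoping replaces `P_Λ T^k` by `(T^Λ)^k P_Λ` at the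
cost of `k` terms, each containing the factor `P_Λ (T - T^Λ ⊕ T^{Λᶜ})`. The trace of each is at most
its trace norm, hence `o(|Λ|)` (`norm_sum_inner_pow_le`). What remains is the trace of `(T^Λ)^k`, a
sum of `|Λ|` eigenvalues of modulus at most `r^k` (`norm_trace_pow_le`). Letting the box grow gives
the bound (`norm_dosMoment_le`).

Hence `ψ(z) = ∑ conj(m_k) z^k` converges for `r|z| < 1`. For `ρ < 1`, Parseval's identity says that
`L` of the dilate `f(ρ·)`, which is `∑ c_k ρ^k m_k`, is the mean of `f(ρe^{it}) conj ψ(e^{it})`, and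
the theorem is the limit `ρ → 1`. The Fourier coefficient of `conj ψ` at index zero is `m_0 = 1`, so
this function is not in `H¹₀`.

The limit needs three classical facts. Von Neumann's inequality bounds `f_ρ(T)` by `sup |f|`; it
comes from the positivity of an operator Poisson kernel. Strong convergence of `f_ρ(T)` holds first
on defect vectors `h - TT*h`, where square summable coefficients suffice. It then extends to a dense
subspace because `T` is completely non unitary, and to all vectors by von Neumann's inequality.
Fatou's theorem gives radial limits of `f`: a primitive of `f` is Lipschitz, so it is differentiable
along the circle almost everywhere, and a kernel estimate turns that derivative into the radial
limit of `f`. -/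

theorem hasSum_intervalIntegral_of_norm_le {F : ℕ → ℝ → ℂ} {u : ℕ → ℝ}
    (hF : ∀ n, Continuous (F n)) (hu : Summable u) (hb : ∀ n t, ‖F n t‖ ≤ u n) (a b : ℝ) :
    HasSum (fun n => ∫ t in a..b, F n t) (∫ t in a..b, ∑' n, F n t) := by
  refine intervalIntegral.hasSum_integral_of_dominated_convergence (fun n _ => u n)
    (fun n => (hF n).aestronglyMeasurable) (fun n => ae_of_all _ fun t _ => hb n t)
    (ae_of_all _ fun _ _ => hu) intervalIntegrable_const (ae_of_all _ fun t _ => ?_)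
  exact (Summable.of_norm_bounded hu fun n => hb n t).hasSum

theorem integral_exp_int (k : ℤ) :
    ∫ t in (0 : ℝ)..(2 * Real.pi), Complex.exp (k * (t * Complex.I)) =
      if k = 0 then (2 * Real.pi : ℂ) else 0 := by
  split_ifs with h
  · simp [h]
  · have hc : ((k : ℂ) * Complex.I) ≠ 0 := by simp [h]
    have := integral_exp_mul_complex (a := 0) (b := 2 * Real.pi) hc
    rw [show (fun t : ℝ => Complex.exp (k * (t * Complex.I))) =
      fun t : ℝ => Complex.exp (k * Complex.I * t) by ext t; ring_nf, this]
    have h1 : Complex.exp (k * Complex.I * ((2 * Real.pi : ℝ) : ℂ)) = 1 := by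
      rw [Complex.exp_eq_one_iff]; exact ⟨k, by push_cast; ring⟩
    rw [h1]; simp

theorem norm_circle (t : ℝ) : ‖Complex.exp (t * Complex.I)‖ = 1 :=
  Complex.norm_exp_ofReal_mul_I t

theorem circle_pow_mul_conj_pow (n m : ℕ) (t : ℝ) :
    Complex.exp (t * Complex.I) ^ n * conj (Complex.exp (t * Complex.I)) ^ m =
      Complex.exp (((n - m : ℤ) : ℂ) * (t * Complex.I)) := by
  rw [← Complex.exp_conj, ← Complex.exp_nat_mul, ← Complex.exp_nat_mul, ← Complex.exp_add]
  congr 1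
  simp
  ring

theorem continuous_tsum_circle {a : ℕ → ℂ} (ha : Summable fun n => ‖a n‖) :
    Continuous fun t : ℝ => ∑' n, a n * Complex.exp (t * Complex.I) ^ n := by
  refine continuous_tsum (fun n => by fun_prop) ha fun n t => ?_
  simp

/-- Fourier coefficients of an absolutely convergent power series. -/
theorem integral_tsum_circle_mul {a : ℕ → ℂ} (ha : Summable fun n => ‖a n‖) {g : ℝ → ℂ}
    (hg : Continuous g) (hg1 : ∀ t, ‖g t‖ ≤ 1) :
    HasSum (fun n => a n * ∫ t in (0 : ℝ)..(2 * Real.pi), Complex.exp (t * Complex.I) ^ n * g t)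
      (∫ t in (0 : ℝ)..(2 * Real.pi), (∑' n, a n * Complex.exp (t * Complex.I) ^ n) * g t) := by
  have := hasSum_intervalIntegral_of_norm_le
    (F := fun n t => a n * (Complex.exp (t * Complex.I) ^ n * g t)) (u := fun n => ‖a n‖)
    (fun n => by fun_prop) ha (fun n t => by
      simp only [norm_mul, norm_pow, norm_circle, one_pow, one_mul]
      exact mul_le_of_le_one_right (norm_nonneg _) (hg1 t)) 0 (2 * Real.pi)
  simp only [intervalIntegral.integral_const_mul] at this
  convert this using 3 with t
  rw [← tsum_mul_right]
  simp only [mul_assoc]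

theorem integral_tsum_circle_mul_conj_pow {a : ℕ → ℂ} (ha : Summable fun n => ‖a n‖) (m : ℕ) :
    ∫ t in (0 : ℝ)..(2 * Real.pi), (∑' n, a n * Complex.exp (t * Complex.I) ^ n) *
      conj (Complex.exp (t * Complex.I)) ^ m = 2 * Real.pi * a m := by
  rw [← (integral_tsum_circle_mul ha (g := fun t => conj (Complex.exp (t * Complex.I)) ^ m)
    (by fun_prop) (fun t => by simp)).tsum_eq, tsum_eq_single m]
  · simp only [circle_pow_mul_conj_pow, integral_exp_int]
    simp [mul_comm]
  · intro n hn
    simp only [circle_pow_mul_conj_pow, integral_exp_int]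
    rw [if_neg (by omega), mul_zero]

theorem integral_tsum_circle_mul_pow {a : ℕ → ℂ} (ha : Summable fun n => ‖a n‖) (m : ℕ) :
    ∫ t in (0 : ℝ)..(2 * Real.pi), (∑' n, a n * Complex.exp (t * Complex.I) ^ n) *
      Complex.exp (t * Complex.I) ^ m = if m = 0 then 2 * Real.pi * a 0 else 0 := by
  have key (n : ℕ) : ∫ t in (0 : ℝ)..(2 * Real.pi),
      Complex.exp (t * Complex.I) ^ n * Complex.exp (t * Complex.I) ^ m =
        if n + m = 0 then (2 * Real.pi : ℂ) else 0 := by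
    have := integral_exp_int ((n + m : ℕ) : ℤ)
    simp only [Int.cast_natCast, Complex.exp_nat_mul, pow_add, Nat.cast_eq_zero] at this
    exact this
  rw [← (integral_tsum_circle_mul ha (g := fun t => Complex.exp (t * Complex.I) ^ m)
    (by fun_prop) (fun t => by simp)).tsum_eq, tsum_eq_single 0]
  · rw [key]
    simp [mul_comm]
  · intro n hn
    rw [key, if_neg (by omega), mul_zero]

theorem norm_tsum_circle_le {a : ℕ → ℂ} (ha : Summable fun n => ‖a n‖) (t : ℝ) :
    ‖∑' n, a n * Complex.exp (t * Complex.I) ^ n‖ ≤ ∑' n, ‖a n‖ := by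
  have h : ∀ n, ‖a n * Complex.exp (t * Complex.I) ^ n‖ = ‖a n‖ := by simp
  refine (norm_tsum_le_tsum_norm (by simpa only [h] using ha)).trans_eq ?_
  simp only [h]

/-- Parseval's identity for absolutely convergent power series. -/
theorem integral_tsum_circle_mul_conj {a b : ℕ → ℂ} (ha : Summable fun n => ‖a n‖)
    (hb : Summable fun n => ‖b n‖) :
    HasSum (fun n => 2 * Real.pi * (a n * conj (b n)))
      (∫ t in (0 : ℝ)..(2 * Real.pi), (∑' n, a n * Complex.exp (t * Complex.I) ^ n) *
        conj (∑' n, b n * Complex.exp (t * Complex.I) ^ n)) := by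
  set G : ℝ → ℂ := fun t => ∑' n, a n * Complex.exp (t * Complex.I) ^ n with hG
  have hGc : Continuous G := continuous_tsum_circle ha
  -- Only the series in `b` is expanded. `G` stays a bounded continuous function, so each term
  -- reduces to one Fourier coefficient of `G`.
  have := hasSum_intervalIntegral_of_norm_le
    (F := fun n t => conj (b n) * (G t * conj (Complex.exp (t * Complex.I)) ^ n))
    (u := fun n => ‖b n‖ * ∑' n, ‖a n‖)
    (fun n => by fun_prop) (hb.mul_right _) (fun n t => by
      simp only [norm_mul, norm_pow, RCLike.norm_conj, norm_circle, one_pow, mul_one]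
      exact mul_le_mul_of_nonneg_left (norm_tsum_circle_le ha t) (norm_nonneg _))
      0 (2 * Real.pi)
  simp only [intervalIntegral.integral_const_mul, hG, integral_tsum_circle_mul_conj_pow ha] at this
  have h2 : ∀ t : ℝ, (∑' n, conj (b n) * ((∑' n, a n * Complex.exp (t * Complex.I) ^ n) *
      conj (Complex.exp (t * Complex.I)) ^ n)) = (∑' n, a n * Complex.exp (t * Complex.I) ^ n) *
        conj (∑' n, b n * Complex.exp (t * Complex.I) ^ n) := fun t => by
    rw [Complex.conj_tsum, ← tsum_mul_left]
    exact tsum_congr fun m => by simp only [map_mul, map_pow]; ring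
  simp only [h2] at this
  exact this.congr_fun fun n => by ring

/-- The orthogonality relation for a power series and a conjugate of a conjugate series. -/
theorem integral_tsum_circle_mul_tsum {a b : ℕ → ℂ} (ha : Summable fun n => ‖a n‖)
    (hb : Summable fun n => ‖b n‖) :
    ∫ t in (0 : ℝ)..(2 * Real.pi), (∑' n, a n * Complex.exp (t * Complex.I) ^ n) *
        (∑' n, b n * Complex.exp (t * Complex.I) ^ n) = 2 * Real.pi * (a 0 * b 0) := by
  set G : ℝ → ℂ := fun t => ∑' n, a n * Complex.exp (t * Complex.I) ^ n with hG
  have hGc : Continuous G := continuous_tsum_circle ha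
  have := hasSum_intervalIntegral_of_norm_le
    (F := fun n t => b n * (G t * Complex.exp (t * Complex.I) ^ n))
    (u := fun n => ‖b n‖ * ∑' n, ‖a n‖)
    (fun n => by fun_prop) (hb.mul_right _) (fun n t => by
      simp only [norm_mul, norm_pow, norm_circle, one_pow, mul_one]
      exact mul_le_mul_of_nonneg_left (norm_tsum_circle_le ha t) (norm_nonneg _))
      0 (2 * Real.pi)
  simp only [intervalIntegral.integral_const_mul, hG, integral_tsum_circle_mul_pow ha] at this
  have h2 : ∀ t : ℝ, (∑' n, b n * ((∑' n, a n * Complex.exp (t * Complex.I) ^ n) *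
      Complex.exp (t * Complex.I) ^ n)) = (∑' n, a n * Complex.exp (t * Complex.I) ^ n) *
        (∑' n, b n * Complex.exp (t * Complex.I) ^ n) := fun t => by
    rw [← tsum_mul_left]
    exact tsum_congr fun m => by ring
  simp only [h2] at this
  rw [← this.tsum_eq, tsum_eq_single 0 (fun n hn => by simp [hn])]
  simp only [if_true]
  ring

/-! ### Taylor coefficients of bounded holomorphic functions -/

/-- The `n`-th Taylor coefficient of `f` at `0`. -/
noncomputable def taylorCoeff (f : ℂ → ℂ) (n : ℕ) : ℂ := iteratedDeriv n f 0 / (n.factorial : ℂ)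

theorem IsHInfty.hasSum {f : ℂ → ℂ} (hf : IsHInfty f) {z : ℂ} (hz : ‖z‖ < 1) :
    HasSum (fun n => taylorCoeff f n * z ^ n) (f z) := by
  refine (Complex.hasSum_taylorSeries_on_ball hf.1 (z := z) (by simpa using hz)).congr_fun
    fun n => ?_
  simp only [taylorCoeff, sub_zero, smul_eq_mul]
  ring

/-- By Parseval, the mean of the squared modulus on the circle is the full sum of squares. -/
theorem sum_norm_sq_le_of_norm_tsum_circle_le {a : ℕ → ℂ} (ha : Summable fun n => ‖a n‖) {C : ℝ}
    (hC : ∀ t : ℝ, ‖∑' n, a n * Complex.exp (t * Complex.I) ^ n‖ ≤ C) (s : Finset ℕ) :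
    ∑ n ∈ s, ‖a n‖ ^ 2 ≤ C ^ 2 := by
  have h := integral_tsum_circle_mul_conj ha ha
  have h0 : (2 * Real.pi : ℝ) > 0 := by positivity
  have h1 : HasSum (fun n => 2 * Real.pi * ‖a n‖ ^ 2) (∫ t in (0 : ℝ)..(2 * Real.pi),
      ‖∑' n, a n * Complex.exp (t * Complex.I) ^ n‖ ^ 2) := by
    rw [← Complex.hasSum_ofReal, ← intervalIntegral.integral_ofReal]
    convert h using 3 with n t
    · rw [Complex.mul_conj']; push_cast; ring
    · rw [Complex.mul_conj']; push_cast; ring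
  have h2 : ∫ t in (0 : ℝ)..(2 * Real.pi),
      ‖∑' n, a n * Complex.exp (t * Complex.I) ^ n‖ ^ 2 ≤ 2 * Real.pi * C ^ 2 := by
    have hc := continuous_tsum_circle ha
    calc _ ≤ ∫ t in (0 : ℝ)..(2 * Real.pi), C ^ 2 :=
          intervalIntegral.integral_mono_on h0.le
            (Continuous.intervalIntegrable (by fun_prop) _ _)
            intervalIntegrable_const
            fun t _ => pow_le_pow_left₀ (norm_nonneg _) (hC t) 2
      _ = _ := by simp
  have h3 := sum_le_hasSum s (fun n _ => by positivity) h1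
  rw [← Finset.mul_sum] at h3
  exact le_of_mul_le_mul_left (h3.trans h2) h0

theorem IsHInfty.summable_norm_mul_pow {f : ℂ → ℂ} (hf : IsHInfty f) {s : ℝ} (hs0 : 0 ≤ s)
    (hs : s < 1) : Summable fun n => ‖taylorCoeff f n * (s : ℂ) ^ n‖ :=
  (hf.hasSum (z := s) (by simpa [abs_of_nonneg hs0] using hs)).summable.norm

theorem IsHInfty.tsum_circle {f : ℂ → ℂ} (hf : IsHInfty f) {s : ℝ} (hs0 : 0 ≤ s) (hs : s < 1)
    (t : ℝ) : ∑' n, taylorCoeff f n * (s : ℂ) ^ n * Complex.exp (t * Complex.I) ^ n =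
      f (s * Complex.exp (t * Complex.I)) := by
  rw [← (hf.hasSum (z := s * Complex.exp (t * Complex.I))
    (by simpa [norm_circle, abs_of_nonneg hs0] using hs)).tsum_eq]
  exact tsum_congr fun n => by rw [mul_pow]; ring

/-- This is `H^∞ ⊆ H²`: the previous bound applies to the dilates `f(s·)`, uniformly as `s → 1`. -/
theorem IsHInfty.sum_norm_sq_le {f : ℂ → ℂ} (hf : IsHInfty f) {C : ℝ}
    (hC : ∀ z ∈ Metric.ball (0 : ℂ) 1, ‖f z‖ ≤ C) (u : Finset ℕ) :
    ∑ n ∈ u, ‖taylorCoeff f n‖ ^ 2 ≤ C ^ 2 := by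
  have h1 : ∀ᶠ s : ℝ in 𝓝[<] 1, ∑ n ∈ u, ‖taylorCoeff f n * (s : ℂ) ^ n‖ ^ 2 ≤ C ^ 2 := by
    filter_upwards [Ioo_mem_nhdsLT (show (0 : ℝ) < 1 by norm_num)] with s hs
    refine sum_norm_sq_le_of_norm_tsum_circle_le (hf.summable_norm_mul_pow hs.1.le hs.2) ?_ u
    intro t
    rw [hf.tsum_circle hs.1.le hs.2]
    apply hC
    simpa [norm_circle, abs_of_pos hs.1] using hs.2
  have h2 : Tendsto (fun s : ℝ => ∑ n ∈ u, ‖taylorCoeff f n * (s : ℂ) ^ n‖ ^ 2) (𝓝[<] 1)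
      (𝓝 (∑ n ∈ u, ‖taylorCoeff f n * ((1 : ℝ) : ℂ) ^ n‖ ^ 2)) :=
    (Continuous.tendsto (by fun_prop) _).mono_left nhdsWithin_le_nhds
  simpa using le_of_tendsto h2 h1

theorem IsHInfty.summable_norm_sq {f : ℂ → ℂ} (hf : IsHInfty f) :
    Summable fun n => ‖taylorCoeff f n‖ ^ 2 := by
  obtain ⟨C, hC⟩ := hf.2
  exact summable_of_sum_le (fun n => by positivity) (hf.sum_norm_sq_le hC)

/-! ### Fatou's theorem on radial limits -/

open Complex Metric in
/-- The Cauchy formula for the derivative on the unit disk, for functions continuous up to the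
boundary. -/
theorem circleIntegral_sub_sq_inv_mul {h : ℂ → ℂ} (hh : DiffContOnCl ℂ h (ball 0 1)) {z : ℂ}
    (hz : z ∈ ball (0 : ℂ) 1) :
    (∮ w in C(0, 1), ((w - z) ^ 2)⁻¹ * h w) = 2 * Real.pi * I * deriv h z := by
  have hnhds : closedBall (0 : ℂ) 1 ∈ 𝓝 z :=
    mem_of_superset (isOpen_ball.mem_nhds hz) ball_subset_closedBall
  have hzd : DifferentiableAt ℂ h z := hh.differentiableAt isOpen_ball hz
  -- Cauchy's integral formula is applied to the difference quotient of `h` at `z`, whose value at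
  -- `z` is `h'(z)`. The constant `h z` contributes nothing, as `(w - z)⁻²` integrates to zero.
  have hs : DiffContOnCl ℂ (dslope h z) (ball 0 1) := by
    refine ⟨(differentiableOn_dslope (isOpen_ball.mem_nhds hz)).2 hh.1, ?_⟩
    rw [closure_ball _ one_ne_zero]
    exact (continuousOn_dslope hnhds).2 ⟨hh.continuousOn_ball, hzd⟩
  have h0 := hs.circleIntegral_sub_inv_smul hz
  rw [dslope_same, smul_eq_mul] at h0
  rw [← h0]
  have h1 : ContinuousOn (fun w : ℂ => ((w - z) ^ 2)⁻¹) (sphere 0 1) := by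
    refine ((continuous_id'.sub continuous_const).pow 2).continuousOn.inv₀ fun w hw h => ?_
    exact sphere_disjoint_ball.ne_of_mem hw hz (sub_eq_zero.mp (sq_eq_zero_iff.mp h))
  have h2 : CircleIntegrable (fun w : ℂ => ((w - z) ^ 2)⁻¹ * h w) 0 1 :=
    ContinuousOn.circleIntegrable zero_le_one
      (h1.mul (hh.continuousOn_ball.mono sphere_subset_closedBall))
  have h3 : CircleIntegrable (fun w : ℂ => ((w - z) ^ 2)⁻¹ * h z) 0 1 :=
    ContinuousOn.circleIntegrable zero_le_one (h1.mul continuousOn_const)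
  have h4 : (∮ w : ℂ in C(0, 1), ((w - z) ^ 2)⁻¹ * h z) = 0 := by
    have h5 : (∮ w : ℂ in C(0, 1), ((w - z) ^ 2)⁻¹) = 0 := by
      simpa using! circleIntegral.integral_sub_zpow_of_ne (by decide : (-2 : ℤ) ≠ -1) 0 z 1
    have := circleIntegral.integral_smul_const (fun w : ℂ => ((w - z) ^ 2)⁻¹) (h z) 0 1
    rwa [h5, zero_smul] at this
  have h6 := circleIntegral.integral_sub h2 h3
  rw [h4, sub_zero] at h6
  rw [← h6]
  refine circleIntegral.integral_congr zero_le_one fun w hw => ?_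
  simp only [dslope_of_ne _ (sphere_disjoint_ball.ne_of_mem hw hz), slope, sq,
    mul_inv, vsub_eq_sub, smul_eq_mul]
  ring

open Complex Metric in
/-- The Cauchy formula for the derivative, with the kernel corrected by its reflection. -/
theorem circleIntegral_reflected_kernel_mul {h : ℂ → ℂ} (hh : DiffContOnCl ℂ h (ball 0 1))
    {z z' : ℂ} (hz : ‖z‖ < 1) (hz' : 1 < ‖z'‖) :
    (∮ w in C(0, 1), (((w - z) ^ 2)⁻¹ - ((w - z') ^ 2)⁻¹) * h w) =
      2 * Real.pi * I * deriv h z := by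
  have hzb : z ∈ ball (0 : ℂ) 1 := by simpa using hz
  have hne : ∀ w ∈ closedBall (0 : ℂ) 1, (w - z') ^ 2 ≠ 0 := fun w hw h => by
    rw [sub_eq_zero.mp (sq_eq_zero_iff.mp h), mem_closedBall_zero_iff] at hw
    exact hz'.not_ge hw
  -- The point `z'` lies outside the closed disk, so the correction is holomorphic inside and
  -- integrates to zero.
  have hd : DiffContOnCl ℂ (fun w : ℂ => ((w - z') ^ 2)⁻¹ * h w) (ball 0 1) := by
    refine DiffContOnCl.smul (c := fun w : ℂ => ((w - z') ^ 2)⁻¹) (DifferentiableOn.diffContOnCl ?_) hh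
    rw [closure_ball _ one_ne_zero]
    exact DifferentiableOn.fun_inv (by fun_prop) hne
  have h1 : ContinuousOn (fun w : ℂ => ((w - z) ^ 2)⁻¹) (sphere 0 1) := by
    refine ((continuous_id'.sub continuous_const).pow 2).continuousOn.inv₀ fun w hw h => ?_
    exact sphere_disjoint_ball.ne_of_mem hw hzb (sub_eq_zero.mp (sq_eq_zero_iff.mp h))
  have hI := circleIntegral.integral_sub (f := fun w => ((w - z) ^ 2)⁻¹ * h w)
    (g := fun w => ((w - z') ^ 2)⁻¹ * h w)
    (ContinuousOn.circleIntegrable zero_le_one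
      (h1.mul (hh.continuousOn_ball.mono sphere_subset_closedBall)))
    (ContinuousOn.circleIntegrable zero_le_one (hd.continuousOn_ball.mono sphere_subset_closedBall))
  simp only [sub_mul, hI]
  rw [hd.circleIntegral_eq_zero zero_le_one, circleIntegral_sub_sq_inv_mul hh hzb, sub_zero]

/-- Both squares equal `1 + ρ² - 2ρ Re(w conj w₀)`. The use is the distance from `w` to the
reflected point: `‖w - w₀/ρ‖ = ‖w - ρw₀‖/ρ`. -/
theorem norm_ofReal_mul_sub_eq (w w₀ : ℂ) (ρ : ℝ) (hw : ‖w‖ = 1) (hw₀ : ‖w₀‖ = 1) :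
    ‖ρ * w - w₀‖ = ‖w - ρ * w₀‖ := by
  have h : ‖(ρ : ℂ) * w - w₀‖ ^ 2 = ‖w - ρ * w₀‖ ^ 2 := by
    have a1 : w.re ^ 2 + w.im ^ 2 = 1 := by
      have := Complex.sq_norm w; rw [hw, Complex.normSq_apply] at this; linarith
    have a2 : w₀.re ^ 2 + w₀.im ^ 2 = 1 := by
      have := Complex.sq_norm w₀; rw [hw₀, Complex.normSq_apply] at this; linarith
    rw [Complex.sq_norm, Complex.sq_norm, Complex.normSq_apply, Complex.normSq_apply]
    simp
    linear_combination (ρ ^ 2 - 1) * a1 + (1 - ρ ^ 2) * a2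
  exact (sq_eq_sq₀ (norm_nonneg _) (norm_nonneg _)).1 h

theorem one_sub_le_norm_sub {w w₀ : ℂ} {ρ : ℝ} (hw : ‖w‖ = 1) (hw₀ : ‖w₀‖ = 1)
    (h0 : 0 < ρ) : 1 - ρ ≤ ‖w - ρ * w₀‖ := by
  have := norm_sub_norm_le w (ρ * w₀)
  rwa [norm_mul, hw, hw₀, Complex.norm_real, Real.norm_of_nonneg h0.le, mul_one] at this

theorem norm_sub_le_two_mul {w w₀ : ℂ} {ρ : ℝ} (hw : ‖w‖ = 1) (hw₀ : ‖w₀‖ = 1)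
    (h0 : 0 < ρ) (h1 : ρ < 1) : ‖w - w₀‖ ≤ 2 * ‖w - ρ * w₀‖ := by
  have h2 : ‖(ρ : ℂ) * w₀ - w₀‖ = 1 - ρ := by
    rw [show (ρ : ℂ) * w₀ - w₀ = ((ρ - 1 : ℝ) : ℂ) * w₀ by push_cast; ring, norm_mul, hw₀,
      Complex.norm_real, Real.norm_of_nonpos (by linarith)]
    ring
  have := norm_sub_le_norm_sub_add_norm_sub w (ρ * w₀) w₀
  linarith [one_sub_le_norm_sub hw hw₀ h0]

/-- The reflected kernel is dominated by the Poisson kernel. -/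
theorem norm_sub_mul_norm_reflected_kernel_le {w w₀ : ℂ} {ρ : ℝ} (hw : ‖w‖ = 1) (hw₀ : ‖w₀‖ = 1)
    (h0 : 0 < ρ) (h1 : ρ < 1) :
    ‖w - w₀‖ * ‖((w - ρ * w₀) ^ 2)⁻¹ - ((w - (ρ : ℂ)⁻¹ * w₀) ^ 2)⁻¹‖ ≤
      4 * ((1 - ρ ^ 2) / ‖w - ρ * w₀‖ ^ 2) := by
  set a := ‖w - ρ * w₀‖ with ha
  have hρ : (ρ : ℂ) ≠ 0 := by exact_mod_cast h0.ne'
  have hapos : 0 < a := lt_of_lt_of_le (by linarith) (one_sub_le_norm_sub hw hw₀ h0)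
  have hb : ‖w - (ρ : ℂ)⁻¹ * w₀‖ = a / ρ := by
    rw [ha, ← norm_ofReal_mul_sub_eq w w₀ ρ hw hw₀,
      show w - (ρ : ℂ)⁻¹ * w₀ = (ρ : ℂ)⁻¹ * (ρ * w - w₀) by field_simp, norm_mul, norm_inv,
      Complex.norm_real, Real.norm_of_nonneg h0.le]
    field_simp
  have hA : w - ρ * w₀ ≠ 0 := norm_pos_iff.1 hapos
  have hB : w - (ρ : ℂ)⁻¹ * w₀ ≠ 0 := norm_pos_iff.1 (by rw [hb]; positivity)
  have hK : ‖((w - ρ * w₀) ^ 2)⁻¹ - ((w - (ρ : ℂ)⁻¹ * w₀) ^ 2)⁻¹‖ ≤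
      2 * (1 - ρ ^ 2) / a ^ 3 := by
    -- A difference of squares: the factor `ρ - ρ⁻¹`, of modulus `(1 - ρ²)/ρ`, is the gain from
    -- subtracting the reflected kernel.
    have e : ((w - ρ * w₀) ^ 2)⁻¹ - ((w - (ρ : ℂ)⁻¹ * w₀) ^ 2)⁻¹ =
        ((ρ - ρ⁻¹ : ℝ) : ℂ) * w₀ * ((w - ρ * w₀) + (w - (ρ : ℂ)⁻¹ * w₀)) *
          (((w - ρ * w₀) ^ 2)⁻¹ * ((w - (ρ : ℂ)⁻¹ * w₀) ^ 2)⁻¹) := by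
      rw [inv_sub_inv (pow_ne_zero 2 hA) (pow_ne_zero 2 hB), div_eq_mul_inv, mul_inv]
      push_cast
      ring
    rw [e, norm_mul, norm_mul, norm_mul, norm_mul, norm_inv, norm_inv, norm_pow, norm_pow, hb,
      ← ha, hw₀, Complex.norm_real]
    have e2 : ‖ρ - ρ⁻¹‖ = (1 - ρ ^ 2) / ρ := by
      rw [Real.norm_of_nonpos]
      · field_simp; ring
      · have := (one_lt_inv₀ h0).2 h1; linarith
    rw [e2]
    have e3 : ‖w - ρ * w₀ + (w - (ρ : ℂ)⁻¹ * w₀)‖ ≤ a + a / ρ := (norm_add_le _ _).trans_eq (by rw [hb])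
    have h12 : 0 ≤ 1 - ρ ^ 2 := by nlinarith
    calc _ ≤ (1 - ρ ^ 2) / ρ * 1 * (a + a / ρ) * ((a ^ 2)⁻¹ * ((a / ρ) ^ 2)⁻¹) := by gcongr
      _ = (1 + ρ) * (1 - ρ ^ 2) / a ^ 3 := by field_simp; ring
      _ ≤ _ := by gcongr; linarith
  calc _ ≤ (2 * a) * (2 * (1 - ρ ^ 2) / a ^ 3) :=
        mul_le_mul (norm_sub_le_two_mul hw hw₀ h0 h1) hK (norm_nonneg _) (by positivity)
    _ = _ := by field_simp; ring

open Complex Metric in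
-- Represent `h'(ρw₀)` with the reflected kernel and split the circle at distance `η` from `w₀`. On
-- the near part the integrand is at most `4ε` times the Poisson kernel, which has mean one. On the
-- far part `‖w - ρw₀‖ ≥ η/2`, which leaves a term vanishing as `ρ → 1`.
theorem norm_deriv_le_of_small_near {h : ℂ → ℂ} (hh : DiffContOnCl ℂ h (ball 0 1)) {w₀ : ℂ}
    (hw₀ : ‖w₀‖ = 1) {M ε η : ℝ} (hM : 0 ≤ M) (hε : 0 ≤ ε) (hη : 0 < η)
    (h1 : ∀ w : ℂ, ‖w‖ = 1 → ‖h w‖ ≤ M * ‖w - w₀‖)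
    (h2 : ∀ w : ℂ, ‖w‖ = 1 → ‖w - w₀‖ < η → ‖h w‖ ≤ ε * ‖w - w₀‖) {ρ : ℝ} (hρ0 : 0 < ρ)
    (hρ1 : ρ < 1) :
    ‖deriv h (ρ * w₀)‖ ≤ 4 * ε + 16 * M * (1 - ρ ^ 2) / η ^ 2 := by
  have hρ2 : 0 ≤ 1 - ρ ^ 2 := by nlinarith
  have hz : ‖(ρ : ℂ) * w₀‖ < 1 := by simpa [hw₀, abs_of_pos hρ0] using hρ1
  have hz' : 1 < ‖(ρ : ℂ)⁻¹ * w₀‖ := by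
    simpa [hw₀, abs_of_pos hρ0] using (one_lt_inv₀ hρ0).2 hρ1
  have hrep := circleIntegral_reflected_kernel_mul hh hz hz'
  have hP := DiffContOnCl.circleAverage_poissonKernel_smul
    (f := fun _ => (1 : ℂ)) (c := 0) (R := 1) (w := ρ * w₀) diffContOnCl_const (by simpa using hz)
  set P : ℝ → ℝ := fun θ => (1 - ρ ^ 2) / ‖circleMap 0 1 θ - ρ * w₀‖ ^ 2 with hPdef
  have hPint : ∫ θ in (0 : ℝ)..(2 * Real.pi), P θ = 2 * Real.pi := by
    rw [Real.circleAverage_def] at hP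
    have e : ∀ θ : ℝ, (poissonKernel 0 (ρ * w₀) • fun _ : ℂ => (1 : ℂ)) (circleMap 0 1 θ) =
        ((P θ : ℝ) : ℂ) := fun θ => by
      simp [poissonKernel_def, hPdef, hw₀]
    simp only [e, intervalIntegral.integral_ofReal] at hP
    have hpi := Real.pi_pos
    have h3 : (2 * Real.pi)⁻¹ * ∫ θ in (0 : ℝ)..(2 * Real.pi), P θ = 1 := by
      have : (((2 * Real.pi)⁻¹ * ∫ θ in (0 : ℝ)..(2 * Real.pi), P θ : ℝ) : ℂ) = ((1 : ℝ) : ℂ) := by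
        rw [Complex.ofReal_mul]
        simpa [Complex.real_smul] using hP
      exact_mod_cast this
    field_simp at h3
    linarith
  have hPcont : Continuous P := by
    refine continuous_const.div (by fun_prop) fun θ => ?_
    have := one_sub_le_norm_sub (w := circleMap 0 1 θ) (by simp) hw₀ hρ0
    have : 0 < ‖circleMap 0 1 θ - ρ * w₀‖ := by linarith
    positivity
  have hbound : ∀ θ : ℝ, ‖deriv (circleMap 0 1) θ •
      ((((circleMap 0 1 θ - ρ * w₀) ^ 2)⁻¹ - ((circleMap 0 1 θ - (ρ : ℂ)⁻¹ * w₀) ^ 2)⁻¹) *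
        h (circleMap 0 1 θ))‖ ≤ 4 * ε * P θ + 16 * M * (1 - ρ ^ 2) / η ^ 2 := by
    intro θ
    have hw : ‖circleMap 0 1 θ‖ = 1 := by simp
    set w := circleMap 0 1 θ with hwdef
    have hk := norm_sub_mul_norm_reflected_kernel_le hw hw₀ hρ0 hρ1
    rw [norm_smul, deriv_circleMap, norm_mul, norm_mul, norm_I, norm_circleMap_zero, abs_one,
      one_mul, one_mul]
    have hPn : 0 ≤ P θ := by positivity
    rcases lt_or_ge ‖w - w₀‖ η with hlt | hge
    · calc _ ≤ ‖((w - ρ * w₀) ^ 2)⁻¹ - ((w - (ρ : ℂ)⁻¹ * w₀) ^ 2)⁻¹‖ * (ε * ‖w - w₀‖) := by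
            gcongr; exact h2 w hw hlt
        _ = ε * (‖w - w₀‖ * ‖((w - ρ * w₀) ^ 2)⁻¹ - ((w - (ρ : ℂ)⁻¹ * w₀) ^ 2)⁻¹‖) := by ring
        _ ≤ ε * (4 * P θ) := by gcongr
        _ ≤ _ := by
            have : 0 ≤ 16 * M * (1 - ρ ^ 2) / η ^ 2 := by positivity
            linarith
    · have h3 : η / 2 ≤ ‖w - ρ * w₀‖ := by linarith [norm_sub_le_two_mul hw hw₀ hρ0 hρ1]
      calc _ ≤ ‖((w - ρ * w₀) ^ 2)⁻¹ - ((w - (ρ : ℂ)⁻¹ * w₀) ^ 2)⁻¹‖ * (M * ‖w - w₀‖) := by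
            gcongr; exact h1 w hw
        _ = M * (‖w - w₀‖ * ‖((w - ρ * w₀) ^ 2)⁻¹ - ((w - (ρ : ℂ)⁻¹ * w₀) ^ 2)⁻¹‖) := by ring
        _ ≤ M * (4 * ((1 - ρ ^ 2) / (η / 2) ^ 2)) := by
            refine mul_le_mul_of_nonneg_left (hk.trans ?_) hM
            gcongr
        _ = 16 * M * (1 - ρ ^ 2) / η ^ 2 := by ring
        _ ≤ _ := by
            have : 0 ≤ 4 * ε * P θ := by positivity
            linarith
  have hint := intervalIntegral.norm_integral_le_of_norm_le (a := 0) (b := 2 * Real.pi)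
    (μ := volume) Real.two_pi_pos.le (ae_of_all _ fun θ _ => hbound θ)
    (Continuous.intervalIntegrable (by fun_prop) _ _)
  rw [intervalIntegral.integral_add (Continuous.intervalIntegrable (by fun_prop) _ _)
    intervalIntegrable_const, intervalIntegral.integral_const_mul, hPint,
    intervalIntegral.integral_const, smul_eq_mul] at hint
  unfold circleIntegral at hrep
  rw [hrep, norm_mul, norm_mul, norm_mul, norm_I] at hint
  simp only [Complex.norm_ofNat, Complex.norm_real, Real.norm_of_nonneg Real.pi_pos.le] at hint
  have hpi := Real.two_pi_pos
  have : 2 * Real.pi * ‖deriv h (ρ * w₀)‖ ≤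
      2 * Real.pi * (4 * ε + 16 * M * (1 - ρ ^ 2) / η ^ 2) := by linarith
  exact le_of_mul_le_mul_left this hpi

/-! ### Differentiability along the circle and radial limits -/

open Complex in
theorem exp_arg_div {w w₀ : ℂ} (hw : ‖w‖ = 1) (hw₀ : ‖w₀‖ = 1) :
    w₀ * exp (arg (w / w₀) * I) = w := by
  have h : ‖w / w₀‖ = 1 := by simp [hw, hw₀]
  have h2 := norm_mul_exp_arg_mul_I (w / w₀)
  rw [h, ofReal_one, one_mul] at h2
  rw [h2, mul_div_cancel₀]
  exact norm_pos_iff.1 (by rw [hw₀]; exact one_pos)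

open Complex Asymptotics in
/-- Differentiability along the circle in terms of the chordal distance. -/
theorem isLittleO_circle_of_hasDerivAt {h : ℂ → ℂ} {t₀ : ℝ}
    (hd : HasDerivAt (fun t : ℝ => h (exp (t * I))) 0 t₀) (h0 : h (exp (t₀ * I)) = 0) {ε : ℝ}
    (hε : 0 < ε) :
    ∃ η > 0, ∀ w : ℂ, ‖w‖ = 1 → ‖w - exp (t₀ * I)‖ < η → ‖h w‖ ≤ ε * ‖w - exp (t₀ * I)‖ := by
  set w₀ := exp (t₀ * I) with hw₀def
  have hw₀ : ‖w₀‖ = 1 := norm_circle t₀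
  have hne : w₀ ≠ 0 := exp_ne_zero _
  have hlog : HasDerivAt (fun w : ℂ => log (w / w₀)) (1 / w₀ / (w₀ / w₀)) w₀ :=
    ((hasDerivAt_id w₀).div_const w₀).clog (by simp [div_self hne])
  -- The angle from `w₀` to `w` is the imaginary part of a logarithm differentiable at `w₀`, hence
  -- at most a constant times the chord near `w₀`.
  have hO : (fun w : ℂ => arg (w / w₀)) =O[𝓝 w₀] fun w => w - w₀ := by
    have h1 := hlog.isBigO_sub
    simp only [div_self hne, log_one, sub_zero] at h1
    refine IsBigO.trans (IsBigO.of_bound 1 (Eventually.of_forall fun w => ?_)) h1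
    rw [one_mul, ← log_im]
    exact abs_im_le_norm _
  have htend : Tendsto (fun w : ℂ => t₀ + arg (w / w₀)) (𝓝 w₀) (𝓝 t₀) := by
    have : Tendsto (fun w : ℂ => arg (w / w₀)) (𝓝 w₀) (𝓝 0) :=
      hO.trans_tendsto (by simpa using (continuous_sub_right w₀).tendsto w₀)
    simpa using this.const_add t₀
  have ho := hd.isLittleO.comp_tendsto htend
  simp only [Function.comp_def, smul_zero, sub_zero, ← hw₀def, h0, add_sub_cancel_left] at ho
  have hfin := (ho.trans_isBigO hO).def hε
  obtain ⟨η, hη, hη2⟩ := Metric.eventually_nhds_iff.1 hfin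
  refine ⟨η, hη, fun w hw hlt => ?_⟩
  have := hη2 (by rwa [dist_eq_norm] : dist w w₀ < η)
  have e : exp (((t₀ + arg (w / w₀) : ℝ) : ℂ) * I) = w := by
    rw [ofReal_add, add_mul, exp_add, ← hw₀def, exp_arg_div hw hw₀]
  rwa [e] at this

open Complex in
theorem hasDerivAt_circle (t : ℝ) : HasDerivAt (fun t : ℝ => exp (t * I)) (exp (t * I) * I) t := by
  have := ((hasDerivAt_id t).ofReal_comp.mul_const I).cexp
  simpa using this

open Complex Metric in
/-- **Fatou's theorem**: bounded holomorphic functions on the disk have radial limits almost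
everywhere. -/
theorem IsHInfty.ae_exists_tendsto {f : ℂ → ℂ} (hf : IsHInfty f) :
    ∀ᵐ t : ℝ, ∃ b : ℂ, Tendsto (fun ρ : ℝ => f (ρ * exp (t * I))) (𝓝[<] (1 : ℝ)) (𝓝 b) := by
  obtain ⟨C, hC⟩ := hf.2
  -- A primitive of a bounded function is Lipschitz on the disk. It extends to a Lipschitz `g` on
  -- the plane, and `t ↦ g(e^{it})` is differentiable almost everywhere.
  obtain ⟨F, hF⟩ := hf.1.isExactOn_ball
  have hC0 : 0 ≤ C := (norm_nonneg _).trans (hC 0 (by simp))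
  have hLip : LipschitzOnWith C.toNNReal F (ball 0 1) :=
    (convex_ball 0 1).lipschitzOnWith_of_nnnorm_hasDerivWithin_le
      (fun x hx => (hF x hx).hasDerivWithinAt)
      (fun x hx => by rw [← NNReal.coe_le_coe]; simpa [hC0] using hC x hx)
  obtain ⟨g, hg, hgF⟩ := hLip.extend_finite_dimension
  set K := lipschitzExtensionConstant ℂ * C.toNNReal
  have hgd : ∀ z ∈ ball (0 : ℂ) 1, HasDerivAt g (f z) z := fun z hz =>
    (hF z hz).congr_of_eventuallyEq (hgF.symm.eventuallyEq_of_mem (isOpen_ball.mem_nhds hz))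
  have hexp : LipschitzWith 1 fun t : ℝ => exp (t * I) := by
    refine lipschitzWith_of_nnnorm_deriv_le (fun t => ?_) fun t => ?_
    · exact ((hasDerivAt_circle t).differentiableAt)
    · rw [(hasDerivAt_circle t).deriv]
      rw [← NNReal.coe_le_coe]
      simp
  filter_upwards [(hg.comp hexp).ae_differentiableAt_real] with t₀ ht₀
  set w₀ := exp (t₀ * I) with hw₀def
  have hw₀ : ‖w₀‖ = 1 := norm_circle t₀
  have hne : w₀ ≠ 0 := exp_ne_zero _
  -- By the chain rule, the candidate for the boundary value of `f = g'` is the derivative along the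
  -- circle divided by that of `e^{it}`. Subtracting the affine function with slope `b` reduces to a
  -- vanishing tangential derivative.
  set b : ℂ := deriv (g ∘ fun t : ℝ => exp (t * I)) t₀ / (w₀ * I) with hb
  refine ⟨b, ?_⟩
  set h : ℂ → ℂ := fun w => g w - g w₀ - b * (w - w₀) with hh
  have hhd : ∀ z ∈ ball (0 : ℂ) 1, HasDerivAt h (f z - b) z := fun z hz => by
    have := ((hgd z hz).sub_const (g w₀)).sub (((hasDerivAt_id z).sub_const w₀).const_mul b)
    rw [mul_one] at this
    exact this
  have hcont : Continuous g := hg.continuous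
  have hdc : DiffContOnCl ℂ h (ball 0 1) :=
    ⟨fun z hz => (hhd z hz).differentiableAt.differentiableWithinAt,
      Continuous.continuousOn (by fun_prop)⟩
  have hderiv : HasDerivAt (fun t : ℝ => h (exp (t * I))) 0 t₀ := by
    have h1 := (ht₀.hasDerivAt.sub_const (g w₀)).sub
      (((hasDerivAt_circle t₀).sub_const w₀).const_mul b)
    have h2 : b * (exp (t₀ * I) * I) = deriv (g ∘ fun t : ℝ => exp (t * I)) t₀ := by
      rw [hb, ← hw₀def, div_mul_cancel₀ _ (mul_ne_zero hne I_ne_zero)]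
    rw [h2, sub_self] at h1
    exact h1
  have h00 : h (exp (t₀ * I)) = 0 := by simp [hh, ← hw₀def]
  have hM : ∀ w : ℂ, ‖w‖ = 1 → ‖h w‖ ≤ (K + ‖b‖) * ‖w - w₀‖ := fun w _ => by
    have h1 := hg.dist_le_mul w w₀
    rw [dist_eq_norm, dist_eq_norm] at h1
    calc ‖h w‖ ≤ ‖g w - g w₀‖ + ‖b * (w - w₀)‖ := norm_sub_le _ _
      _ ≤ K * ‖w - w₀‖ + ‖b‖ * ‖w - w₀‖ := add_le_add h1 (norm_mul_le _ _)
      _ = _ := by ring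
  rw [tendsto_iff_norm_sub_tendsto_zero]
  refine tendsto_order.2 ⟨fun a ha => Eventually.of_forall fun ρ => ha.trans_le (norm_nonneg _),
    fun a ha => ?_⟩
  -- With `ε = a/8` the near part contributes `a/2`, leaving room for the far part, which tends to
  -- zero.
  obtain ⟨η, hη, hsmall⟩ := isLittleO_circle_of_hasDerivAt hderiv h00 (ε := a / 8) (by positivity)
  have hlim : Tendsto (fun ρ : ℝ => 4 * (a / 8) + 16 * (K + ‖b‖) * (1 - ρ ^ 2) / η ^ 2)
      (𝓝[<] 1) (𝓝 (4 * (a / 8) + 16 * (K + ‖b‖) * (1 - 1 ^ 2) / η ^ 2)) :=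
    (Continuous.tendsto (by fun_prop) _).mono_left nhdsWithin_le_nhds
  filter_upwards [hlim.eventually_lt_const (u := a) (by simp; linarith),
    Ioo_mem_nhdsLT (show (0 : ℝ) < 1 by norm_num)] with ρ hρ hρ01
  have := norm_deriv_le_of_small_near hdc hw₀ (M := K + ‖b‖) (by positivity) (by positivity) hη hM
    hsmall hρ01.1 hρ01.2
  rw [(hhd (ρ * w₀) (by simpa [hw₀, abs_of_pos hρ01.1] using hρ01.2)).deriv] at this
  exact this.trans_lt hρ

theorem IsHInfty.ae_tendsto_boundaryValue {f : ℂ → ℂ} (hf : IsHInfty f) :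
    ∀ᵐ t : ℝ, Tendsto (fun ρ : ℝ => f (ρ * Complex.exp (t * Complex.I))) (𝓝[<] (1 : ℝ))
      (𝓝 (boundaryValue f t)) := by
  filter_upwards [hf.ae_exists_tendsto] with t ht
  exact tendsto_nhds_limUnder ht

/-! ### von Neumann's inequality -/

section Calculus

variable {H : Type*} [NormedAddCommGroup H] [InnerProductSpace ℂ H]

theorem norm_pow_le_one_of_norm_le_one {T : H →L[ℂ] H} (hT : ‖T‖ ≤ 1) (n : ℕ) : ‖T ^ n‖ ≤ 1 := by
  rcases n.eq_zero_or_pos with rfl | hn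
  · rw [pow_zero]
    exact ContinuousLinearMap.norm_id_le
  · exact (norm_pow_le' T hn).trans (pow_le_one₀ (norm_nonneg _) hT)

theorem norm_apply_le_of_norm_le_one {T : H →L[ℂ] H} (hT : ‖T‖ ≤ 1) (x : H) : ‖T x‖ ≤ ‖x‖ :=
  (T.le_of_opNorm_le hT x).trans_eq (one_mul _)

theorem summable_norm_inner_pow {A : H →L[ℂ] H} (hA : ‖A‖ < 1) (x y : H) :
    Summable fun n : ℕ => ‖(inner ℂ ((A ^ n) x) y : ℂ)‖ := by
  refine Summable.of_nonneg_of_le (fun n => norm_nonneg _) (fun n => ?_)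
    ((summable_geometric_of_lt_one (norm_nonneg A) hA).mul_right (‖x‖ * ‖y‖))
  rw [← mul_assoc]
  refine (norm_inner_le_norm _ _).trans (mul_le_mul_of_nonneg_right ?_ (norm_nonneg _))
  rcases n.eq_zero_or_pos with rfl | hn
  · simp
  · exact (A ^ n).le_of_opNorm_le (norm_pow_le' A hn) x

theorem dilatedCalc_eq (f : ℂ → ℂ) (ρ : ℝ) (T : H →L[ℂ] H) :
    dilatedCalc f ρ T = ∑' n, (taylorCoeff f n * (ρ : ℂ) ^ n) • T ^ n := rfl

/-- The sesquilinear Poisson kernel of a strict contraction. -/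
noncomputable def poissonForm (A : H →L[ℂ] H) (y x : H) (t : ℝ) : ℂ :=
  conj (∑' n, inner ℂ ((A ^ n) x) y * Complex.exp (t * Complex.I) ^ n) +
    (∑' n, inner ℂ ((A ^ n) y) x * Complex.exp (t * Complex.I) ^ n) - inner ℂ y x

theorem continuous_poissonForm {A : H →L[ℂ] H} (hA : ‖A‖ < 1) (y x : H) :
    Continuous (poissonForm A y x) := by
  have h1 := continuous_tsum_circle (summable_norm_inner_pow hA x y)
  have h2 := continuous_tsum_circle (summable_norm_inner_pow hA y x)
  unfold poissonForm
  fun_prop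

variable [CompleteSpace H]

/-- Take `N = (1 - conj z A)⁻¹`, summed as a geometric series, with `z = e^{it}`. Writing `y = Ny -
conj z A N y`, and likewise `x`, the mixed terms cancel and `⟨Ny, (1 - A*A) Nx⟩` remains: a positive
semidefinite form. -/
theorem poissonForm_eq {A : H →L[ℂ] H} (hA : ‖A‖ < 1) (t : ℝ) :
    ∃ N : H →L[ℂ] H, ∀ y x : H,
      poissonForm A y x t = inner ℂ (N y) (N x) - inner ℂ (A (N y)) (A (N x)) := by
  set z := Complex.exp (t * Complex.I) with hz
  have hzn : ‖z‖ = 1 := norm_circle t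
  set W : H →L[ℂ] H := conj z • A with hW
  have hWn : ‖W‖ < 1 := by rw [hW, norm_smul, RCLike.norm_conj, hzn, one_mul]; exact hA
  have hsum : HasSum (fun n => W ^ n) (∑' n, W ^ n) := (summable_geometric_of_norm_lt_one hWn).hasSum
  refine ⟨∑' n, W ^ n, fun y x => ?_⟩
  set N := ∑' n, W ^ n with hN
  have hinv : ∀ v, v = N v - conj z • A (N v) := fun v => by
    have := congrArg (fun B : H →L[ℂ] H => B v) (mul_neg_geom_series W hWn)
    simpa [sub_mul, hW] using this.symm
  have hpow : ∀ n v, (W ^ n) v = conj z ^ n • (A ^ n) v := fun n v => by rw [hW, smul_pow]; rfl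
  have hNx : ∀ u v : H, (∑' n, inner ℂ ((A ^ n) u) v * z ^ n) = inner ℂ (N u) v := fun u v => by
    have h1 : HasSum (fun n => (W ^ n) u) (N u) := hsum.mapL (ContinuousLinearMap.apply ℂ H u)
    have h2 := (h1.mapL (innerSL ℂ v)).star
    simp only [innerSL_apply_apply, RCLike.star_def, inner_conj_symm, hpow, inner_smul_left,
      map_pow, RingHomCompTriple.comp_apply, RingHom.id_apply] at h2
    rw [← h2.tsum_eq]
    exact tsum_congr fun n => mul_comm _ _
  rw [poissonForm, ← hz, hNx, hNx, inner_conj_symm]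
  have hzz : z * conj z = 1 := by rw [Complex.mul_conj', hzn]; simp
  have e1 : inner ℂ y (N x) = inner ℂ (N y) (N x) - z * inner ℂ (A (N y)) (N x) := by
    conv_lhs => rw [hinv y]
    rw [inner_sub_left, inner_smul_left, Complex.conj_conj]
  have e2 : inner ℂ (N y) x = inner ℂ (N y) (N x) - conj z * inner ℂ (N y) (A (N x)) := by
    conv_lhs => rw [hinv x]
    rw [inner_sub_right, inner_smul_right]
  have e3 : inner ℂ y x = inner ℂ (N y) (N x) - z * inner ℂ (A (N y)) (N x) -
      conj z * inner ℂ (N y) (A (N x)) + inner ℂ (A (N y)) (A (N x)) := by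
    conv_lhs => rw [hinv x, hinv y]
    simp only [inner_sub_right, inner_smul_right, inner_sub_left, inner_smul_left, Complex.conj_conj]
    linear_combination inner ℂ (A (N y)) (A (N x)) * hzz
  rw [e1, e2, e3]
  ring

/-- Cauchy–Schwarz in its arithmetic mean form: a unimodular `c` makes the off-diagonal value
nonnegative, and positivity is tested on `v - c u`. -/
theorem norm_poissonForm_le {A : H →L[ℂ] H} (hA : ‖A‖ < 1) (y x : H) (t : ℝ) :
    ‖poissonForm A y x t‖ ≤ ((poissonForm A x x t).re + (poissonForm A y y t).re) / 2 := by
  obtain ⟨N, hN⟩ := poissonForm_eq hA t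
  rw [hN, hN, hN]
  set u := N x
  set v := N y
  obtain ⟨c, hc, hcB⟩ : ∃ c : ℂ, ‖c‖ = 1 ∧
      c * (inner ℂ v u - inner ℂ (A v) (A u)) = (‖(inner ℂ v u - inner ℂ (A v) (A u) : ℂ)‖ : ℂ) := by
    set B : ℂ := inner ℂ v u - inner ℂ (A v) (A u)
    rcases eq_or_ne B 0 with h | h
    · exact ⟨1, by simp, by simp [h]⟩
    · refine ⟨‖B‖ / B, by simp [h], by field_simp⟩
  have hpos : 0 ≤ ‖v - c • u‖ ^ 2 - ‖A (v - c • u)‖ ^ 2 := by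
    have := norm_apply_le_of_norm_le_one hA.le (v - c • u)
    have := pow_le_pow_left₀ (norm_nonneg _) this 2
    linarith
  have hre := congrArg Complex.re hcB
  rw [Complex.ofReal_re] at hre
  rw [← hre]
  have h1 : ‖v - c • u‖ ^ 2 = ‖v‖ ^ 2 - 2 * (c * inner ℂ v u).re + ‖u‖ ^ 2 := by
    rw [norm_sub_sq (𝕜 := ℂ), norm_smul, hc, one_mul, inner_smul_right]; rfl
  have h2 : ‖A (v - c • u)‖ ^ 2 = ‖A v‖ ^ 2 - 2 * (c * inner ℂ (A v) (A u)).re + ‖A u‖ ^ 2 := by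
    rw [map_sub, map_smul, norm_sub_sq (𝕜 := ℂ), norm_smul, hc, one_mul, inner_smul_right]; rfl
  have hs : ∀ w : H, (inner ℂ w w : ℂ).re = ‖w‖ ^ 2 := fun w => inner_self_eq_norm_sq (𝕜 := ℂ) w
  rw [Complex.sub_re, Complex.sub_re, hs, hs, hs, hs, mul_sub, Complex.sub_re]
  linarith

theorem hasSum_smul_pow {A : H →L[ℂ] H} (hA : ‖A‖ ≤ 1) {a : ℕ → ℂ} (ha : Summable fun n => ‖a n‖) :
    HasSum (fun n => a n • A ^ n) (∑' n, a n • A ^ n) := by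
  refine (Summable.of_norm_bounded ha fun n => ?_).hasSum
  rw [norm_smul]
  exact mul_le_of_le_one_right (norm_nonneg _) (norm_pow_le_one_of_norm_le_one hA n)

/-- The conjugated series picks out `∑ a_n ⟨y, Aⁿx⟩` by Parseval. The analytic series contributes
only `a_0 ⟨y, x⟩`, which the subtracted term cancels. -/
theorem integral_mul_poissonForm {A : H →L[ℂ] H} (hA : ‖A‖ < 1) {a : ℕ → ℂ}
    (ha : Summable fun n => ‖a n‖) (y x : H) :
    ∫ t in (0 : ℝ)..(2 * Real.pi), (∑' n, a n * Complex.exp (t * Complex.I) ^ n) *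
      poissonForm A y x t = 2 * Real.pi * inner ℂ y ((∑' n, a n • A ^ n) x) := by
  have hp := summable_norm_inner_pow hA x y
  have hq := summable_norm_inner_pow hA y x
  have cg := continuous_tsum_circle ha
  have cp := continuous_tsum_circle hp
  have cq := continuous_tsum_circle hq
  have h0 : ∫ t in (0 : ℝ)..(2 * Real.pi), (∑' n, a n * Complex.exp (t * Complex.I) ^ n) =
      2 * Real.pi * a 0 := by
    simpa using integral_tsum_circle_mul_conj_pow ha 0
  simp only [poissonForm, mul_sub, mul_add]
  rw [intervalIntegral.integral_sub (Continuous.intervalIntegrable (by fun_prop) _ _)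
    (Continuous.intervalIntegrable (by fun_prop) _ _),
    intervalIntegral.integral_add (Continuous.intervalIntegrable (by fun_prop) _ _)
    (Continuous.intervalIntegrable (by fun_prop) _ _), intervalIntegral.integral_mul_const, h0,
    integral_tsum_circle_mul_tsum ha hq, ← (integral_tsum_circle_mul_conj ha hp).tsum_eq]
  have h1 : HasSum (fun n => a n * inner ℂ y ((A ^ n) x)) (inner ℂ y ((∑' n, a n • A ^ n) x)) := by
    have := ((hasSum_smul_pow hA.le ha).mapL (ContinuousLinearMap.apply ℂ H x)).mapL (innerSL ℂ y)
    simpa [inner_smul_right] using this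
  rw [← h1.tsum_eq, ← tsum_mul_left]
  simp only [inner_conj_symm]
  simp
  ring

/-- **von Neumann's inequality** for strict contractions and absolutely convergent power series. -/
theorem norm_tsum_smul_pow_le {A : H →L[ℂ] H} (hA : ‖A‖ < 1) {a : ℕ → ℂ}
    (ha : Summable fun n => ‖a n‖) {C : ℝ}
    (hC : ∀ t : ℝ, ‖∑' n, a n * Complex.exp (t * Complex.I) ^ n‖ ≤ C) :
    ‖∑' n, a n • A ^ n‖ ≤ C := by
  have hC0 : 0 ≤ C := (norm_nonneg _).trans (hC 0)
  -- The series with `a_0 = 1` and no other term shows that the diagonal Poisson form has total mass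
  -- `2π‖x‖²`.
  have hI : ∀ x : H, ∫ t in (0 : ℝ)..(2 * Real.pi), (poissonForm A x x t).re =
      2 * Real.pi * ‖x‖ ^ 2 := fun x => by
    have hs : Summable fun n => ‖(Pi.single 0 1 : ℕ → ℂ) n‖ :=
      summable_of_ne_finset_zero (s := {0}) fun n hn => by
        simp [Finset.mem_singleton.not.1 hn]
    have := integral_mul_poissonForm hA hs x x
    have e1 : ∀ t : ℝ, ∑' n, (Pi.single 0 1 : ℕ → ℂ) n * Complex.exp (t * Complex.I) ^ n = 1 :=
      fun t => by
        rw [tsum_eq_single 0 fun n hn => by simp [hn]]; simp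
    have e2 : ∑' n, (Pi.single 0 1 : ℕ → ℂ) n • A ^ n = 1 := by
      rw [tsum_eq_single 0 fun n hn => by simp [hn]]; simp
    simp only [e1, one_mul, e2, one_apply_eq_self] at this
    have h2 := congrArg Complex.re this
    have e3 : 2 * (Real.pi : ℂ) * inner ℂ x x = ((2 * Real.pi * ‖x‖ ^ 2 : ℝ) : ℂ) := by
      rw [inner_self_eq_norm_sq_to_K]
      simp
    rw [e3, Complex.ofReal_re] at h2
    have h3 := Complex.reCLM.intervalIntegral_comp_comm
      ((continuous_poissonForm hA x x).intervalIntegrable (μ := volume) 0 (2 * Real.pi))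
    simp only [Complex.reCLM_apply] at h3
    rw [h3, h2]
  have key : ∀ x y : H, ‖(inner ℂ y ((∑' n, a n • A ^ n) x) : ℂ)‖ ≤ C * ((‖x‖ ^ 2 + ‖y‖ ^ 2) / 2) := by
    intro x y
    have cx := Complex.continuous_re.comp (continuous_poissonForm hA x x)
    have cy := Complex.continuous_re.comp (continuous_poissonForm hA y y)
    simp only [Function.comp_def] at cx cy
    have h1 := intervalIntegral.norm_integral_le_of_norm_le (a := 0) (b := 2 * Real.pi)
      (f := fun t => (∑' n, a n * Complex.exp (t * Complex.I) ^ n) * poissonForm A y x t)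
      (g := fun t => C * (((poissonForm A x x t).re + (poissonForm A y y t).re) / 2))
      (μ := volume) Real.two_pi_pos.le (ae_of_all _ fun t _ => by
        rw [norm_mul]
        exact mul_le_mul (hC t) (norm_poissonForm_le hA y x t) (norm_nonneg _) hC0)
      (Continuous.intervalIntegrable (by fun_prop) _ _)
    rw [integral_mul_poissonForm hA ha, intervalIntegral.integral_const_mul,
      intervalIntegral.integral_div, intervalIntegral.integral_add
      (Continuous.intervalIntegrable cx _ _)
      (Continuous.intervalIntegrable cy _ _), hI, hI, norm_mul, norm_mul] at h1
    simp only [Complex.norm_ofNat, Complex.norm_real, Real.norm_of_nonneg Real.pi_pos.le] at h1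
    refine le_of_mul_le_mul_left (h1.trans_eq ?_) Real.two_pi_pos
    ring
  refine ContinuousLinearMap.opNorm_le_bound _ hC0 fun x => ?_
  set G := ∑' n, a n • A ^ n
  rcases eq_or_ne (G x) 0 with h | h
  · rw [h, norm_zero]; positivity
  have hg : 0 < ‖G x‖ := norm_pos_iff.2 h
  have hx : 0 < ‖x‖ := norm_pos_iff.2 fun h0 => h (by rw [h0, map_zero])
  -- The test vector is `G x` rescaled to the norm of `x`, where the mean of the two squares equals
  -- `‖x‖²`.
  have := key x (((‖x‖ / ‖G x‖ : ℝ) : ℂ) • G x)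
  rw [inner_smul_left, norm_mul, inner_self_eq_norm_sq_to_K, norm_smul] at this
  simp only [RCLike.norm_conj, Complex.norm_real, Real.norm_of_nonneg (div_nonneg hx.le hg.le),
    norm_pow, Complex.coe_algebraMap, norm_norm] at this
  rw [div_mul_cancel₀ _ hg.ne'] at this
  have e : ‖x‖ / ‖G x‖ * ‖G x‖ ^ 2 = ‖x‖ * ‖G x‖ := by field_simp
  rw [e] at this
  refine le_of_mul_le_mul_left (this.trans_eq ?_) hx
  ring

/-- Split `ρ = s²`: one factor `s` turns `T` into a strict contraction, the other makes the power
series absolutely convergent on the circle. -/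
theorem norm_dilatedCalc_le {f : ℂ → ℂ} (hf : IsHInfty f) {C : ℝ}
    (hC : ∀ z ∈ Metric.ball (0 : ℂ) 1, ‖f z‖ ≤ C) {T : H →L[ℂ] H} (hT : ‖T‖ ≤ 1) {ρ : ℝ}
    (h0 : 0 < ρ) (h1 : ρ < 1) : ‖dilatedCalc f ρ T‖ ≤ C := by
  set s := Real.sqrt ρ with hs
  have hs0 : 0 < s := Real.sqrt_pos.2 h0
  have hs1 : s < 1 := by rw [hs, Real.sqrt_lt' one_pos]; simpa using h1
  have hss : s * s = ρ := Real.mul_self_sqrt h0.le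
  have hA : ‖(s : ℂ) • T‖ < 1 := by
    rw [norm_smul, Complex.norm_real, Real.norm_of_nonneg hs0.le]
    nlinarith [norm_nonneg T]
  have := norm_tsum_smul_pow_le hA (hf.summable_norm_mul_pow hs0.le hs1) (C := C) (fun t => by
    rw [hf.tsum_circle hs0.le hs1]
    apply hC
    simpa [abs_of_pos hs0] using hs1)
  convert this using 2
  rw [dilatedCalc_eq]
  refine tsum_congr fun n => ?_
  rw [smul_pow, smul_smul, ← hss]
  push_cast
  rw [mul_pow, mul_assoc]

theorem hasSum_dilatedCalc {f : ℂ → ℂ} (hf : IsHInfty f) {T : H →L[ℂ] H} (hT : ‖T‖ ≤ 1) {ρ : ℝ}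
    (h0 : 0 ≤ ρ) (h1 : ρ < 1) :
    HasSum (fun n => (taylorCoeff f n * (ρ : ℂ) ^ n) • T ^ n) (dilatedCalc f ρ T) :=
  hasSum_smul_pow hT (hf.summable_norm_mul_pow h0 h1)

end Calculus

/-! ### The functional calculus of a completely non unitary contraction -/

section StrongLimit

variable {H : Type*} [NormedAddCommGroup H] [InnerProductSpace ℂ H]

/-- Abel means of the series `∑ c n • T ^ n x` converge, for every square summable `c`. -/
def AbelConvergent (T : H →L[ℂ] H) (x : H) : Prop :=
  ∀ c : ℕ → ℂ, (Summable fun n => ‖c n‖ ^ 2) →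
    ∃ y, Tendsto (fun ρ : ℝ => ∑' n, (c n * (ρ : ℂ) ^ n) • (T ^ n) x) (𝓝[<] 1) (𝓝 y)

theorem AbelConvergent.smul {T : H →L[ℂ] H} {x : H} (a : ℂ) (hx : AbelConvergent T x) :
    AbelConvergent T (a • x) := fun c hc => by
  obtain ⟨u, hu⟩ := hx c hc
  refine ⟨a • u, (hu.const_smul a).congr fun ρ => ?_⟩
  rw [← tsum_const_smul'']
  exact tsum_congr fun n => by rw [map_smul, smul_comm]

variable [CompleteSpace H]

open ContinuousLinearMap (adjoint)

/-- The operator `D = 1 - TT*` satisfies `0 ≤ D ≤ 1`, hence `D² ≤ D`. The right-hand side telescopes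
along the orbit of `T*`. -/
theorem norm_sub_adjoint_sq_le {T : H →L[ℂ] H} (hT : ‖T‖ ≤ 1) (v : H) :
    ‖v - T (adjoint T v)‖ ^ 2 ≤ ‖v‖ ^ 2 - ‖adjoint T v‖ ^ 2 := by
  rw [norm_sub_sq (𝕜 := ℂ), ← ContinuousLinearMap.adjoint_inner_left]
  have h1 := inner_self_eq_norm_sq (𝕜 := ℂ) (adjoint T v)
  rw [h1]
  have h2 := pow_le_pow_left₀ (norm_nonneg _) (norm_apply_le_of_norm_le_one hT (adjoint T v)) 2
  linarith

theorem adjoint_pow_eq (T : H →L[ℂ] H) (n : ℕ) : adjoint (T ^ n) = adjoint T ^ n := by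
  exact star_pow T n

/-- Duality: pair the sum `y` with itself and move `Tⁿ(1 - TT*)` to the other side. Cauchy–Schwarz
then needs only that the squared norms of `(1 - TT*) T*ⁿ y` sum to at most `‖y‖²`, which is the
telescoping bound. -/
theorem norm_sum_smul_pow_defect_sq_le {T : H →L[ℂ] H} (hT : ‖T‖ ≤ 1) (a : ℕ → ℂ) (h : H)
    (s : Finset ℕ) :
    ‖∑ n ∈ s, a n • (T ^ n) (h - T (adjoint T h))‖ ^ 2 ≤ (∑ n ∈ s, ‖a n‖ ^ 2) * ‖h‖ ^ 2 := by
  set y := ∑ n ∈ s, a n • (T ^ n) (h - T (adjoint T h)) with hy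
  have htel : ∑ n ∈ s, ‖(adjoint T ^ n) y - T (adjoint T ((adjoint T ^ n) y))‖ ^ 2 ≤ ‖y‖ ^ 2 := by
    obtain ⟨N, hN⟩ := s.exists_nat_subset_range
    calc _ ≤ ∑ n ∈ Finset.range N, ‖(adjoint T ^ n) y - T (adjoint T ((adjoint T ^ n) y))‖ ^ 2 :=
          Finset.sum_le_sum_of_subset_of_nonneg hN fun _ _ _ => by positivity
      _ ≤ ∑ n ∈ Finset.range N, (‖(adjoint T ^ n) y‖ ^ 2 - ‖(adjoint T ^ (n + 1)) y‖ ^ 2) := by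
          refine Finset.sum_le_sum fun n _ => ?_
          rw [pow_succ' (adjoint T)]
          exact norm_sub_adjoint_sq_le hT _
      _ = ‖y‖ ^ 2 - ‖(adjoint T ^ N) y‖ ^ 2 := by
          rw [Finset.sum_range_sub' fun n => ‖(adjoint T ^ n) y‖ ^ 2]; simp
      _ ≤ ‖y‖ ^ 2 := by linarith [sq_nonneg ‖(adjoint T ^ N) y‖]
  have hterm : ∀ n, ‖(inner ℂ y (a n • (T ^ n) (h - T (adjoint T h))) : ℂ)‖ ≤
      ‖a n‖ * ‖(adjoint T ^ n) y - T (adjoint T ((adjoint T ^ n) y))‖ * ‖h‖ := fun n => by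
    have e : (inner ℂ y ((T ^ n) (h - T (adjoint T h))) : ℂ) =
        inner ℂ ((adjoint T ^ n) y - T (adjoint T ((adjoint T ^ n) y))) h := by
      rw [← ContinuousLinearMap.adjoint_inner_left, adjoint_pow_eq, inner_sub_right, inner_sub_left,
        ← ContinuousLinearMap.adjoint_inner_left, ContinuousLinearMap.adjoint_inner_right]
    rw [inner_smul_right, norm_mul, e, mul_assoc]
    gcongr
    exact norm_inner_le_norm _ _
  have h1 : ‖y‖ ^ 2 ≤
      (∑ n ∈ s, ‖a n‖ * ‖(adjoint T ^ n) y - T (adjoint T ((adjoint T ^ n) y))‖) * ‖h‖ := by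
    calc ‖y‖ ^ 2 = ‖(inner ℂ y y : ℂ)‖ := by rw [inner_self_eq_norm_sq_to_K]; simp
      _ = ‖∑ n ∈ s, (inner ℂ y (a n • (T ^ n) (h - T (adjoint T h))) : ℂ)‖ := by
          conv_lhs => rw [hy, inner_sum]
      _ ≤ _ := by
          rw [Finset.sum_mul]
          exact norm_sum_le_of_le _ fun n _ => hterm n
  have h2 := Finset.sum_mul_sq_le_sq_mul_sq s (fun n => ‖a n‖)
    fun n => ‖(adjoint T ^ n) y - T (adjoint T ((adjoint T ^ n) y))‖
  have h3 : (‖y‖ ^ 2) ^ 2 ≤ ((∑ n ∈ s, ‖a n‖ ^ 2) * ‖h‖ ^ 2) * ‖y‖ ^ 2 := by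
    calc (‖y‖ ^ 2) ^ 2 ≤ ((∑ n ∈ s,
          ‖a n‖ * ‖(adjoint T ^ n) y - T (adjoint T ((adjoint T ^ n) y))‖) * ‖h‖) ^ 2 :=
          pow_le_pow_left₀ (by positivity) h1 2
      _ = (∑ n ∈ s, ‖a n‖ * ‖(adjoint T ^ n) y - T (adjoint T ((adjoint T ^ n) y))‖) ^ 2 *
          ‖h‖ ^ 2 := by ring
      _ ≤ ((∑ n ∈ s, ‖a n‖ ^ 2) * ‖y‖ ^ 2) * ‖h‖ ^ 2 := by
          gcongr
          exact h2.trans (by gcongr)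
      _ = _ := by ring
  rcases eq_or_ne (‖y‖ ^ 2) 0 with h0 | h0
  · rw [h0]; positivity
  · rw [sq (‖y‖ ^ 2)] at h3
    exact le_of_mul_le_mul_right h3 (lt_of_le_of_ne (by positivity) h0.symm)

theorem summable_smul_pow_defect {T : H →L[ℂ] H} (hT : ‖T‖ ≤ 1) {a : ℕ → ℂ}
    (ha : Summable fun n => ‖a n‖ ^ 2) (h : H) :
    Summable fun n => a n • (T ^ n) (h - T (adjoint T h)) := by
  rw [summable_iff_vanishing_norm]
  intro ε hε
  obtain ⟨s, hs⟩ := summable_iff_vanishing_norm.1 ha (ε ^ 2 / (‖h‖ ^ 2 + 1)) (by positivity)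
  refine ⟨s, fun t ht => ?_⟩
  have h1 := hs t ht
  rw [Real.norm_of_nonneg (Finset.sum_nonneg fun _ _ => by positivity), lt_div_iff₀ (by positivity)]
    at h1
  have h2 := norm_sum_smul_pow_defect_sq_le hT a h t
  have h3 : 0 ≤ ∑ n ∈ t, ‖a n‖ ^ 2 := Finset.sum_nonneg fun _ _ => by positivity
  exact lt_of_pow_lt_pow_left₀ 2 hε.le (by nlinarith)

theorem norm_tsum_smul_pow_defect_sq_le {T : H →L[ℂ] H} (hT : ‖T‖ ≤ 1) {a : ℕ → ℂ}
    (ha : Summable fun n => ‖a n‖ ^ 2) (h : H) :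
    ‖∑' n, a n • (T ^ n) (h - T (adjoint T h))‖ ^ 2 ≤ (∑' n, ‖a n‖ ^ 2) * ‖h‖ ^ 2 := by
  have h1 := (summable_smul_pow_defect hT ha h).hasSum
  refine le_of_tendsto ((h1.norm).pow 2) (Eventually.of_forall fun s => ?_)
  refine (norm_sum_smul_pow_defect_sq_le hT a h s).trans ?_
  gcongr
  exact ha.sum_le_tsum _ fun _ _ => by positivity

/-- Apply the square-sum bound to the coefficients `c_n(ρⁿ - 1)`, whose square sum tends to zero by
dominated convergence. -/
theorem abelConvergent_defect {T : H →L[ℂ] H} (hT : ‖T‖ ≤ 1) (h : H) :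
    AbelConvergent T (h - T (adjoint T h)) := by
  intro c hc
  refine ⟨∑' n, c n • (T ^ n) (h - T (adjoint T h)), ?_⟩
  have hnear : ∀ᶠ ρ : ℝ in 𝓝[<] 1, ρ ∈ Set.Ioo (0 : ℝ) 1 := Ioo_mem_nhdsLT one_pos
  have hb : ∀ ρ ∈ Set.Ioo (0 : ℝ) 1, ∀ n, ‖c n * (ρ : ℂ) ^ n‖ ^ 2 ≤ ‖c n‖ ^ 2 := fun ρ hρ n => by
    rw [norm_mul, norm_pow, Complex.norm_real, Real.norm_of_nonneg hρ.1.le]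
    have h0 := hρ.1.le
    gcongr
    exact mul_le_of_le_one_right (norm_nonneg (c n)) (pow_le_one₀ hρ.1.le hρ.2.le)
  have hb2 : ∀ ρ ∈ Set.Ioo (0 : ℝ) 1, ∀ n, ‖c n * (ρ : ℂ) ^ n - c n‖ ^ 2 ≤ ‖c n‖ ^ 2 :=
    fun ρ hρ n => by
      rw [show c n * (ρ : ℂ) ^ n - c n = c n * ((ρ ^ n - 1 : ℝ) : ℂ) by push_cast; ring, norm_mul,
        Complex.norm_real]
      gcongr
      refine mul_le_of_le_one_right (norm_nonneg (c n)) ?_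
      have h1 := pow_le_one₀ (n := n) hρ.1.le hρ.2.le
      have h2 := pow_nonneg hρ.1.le n
      rw [Real.norm_of_nonpos (by linarith)]
      linarith
  have hlim : Tendsto (fun ρ : ℝ => ∑' n, ‖c n * (ρ : ℂ) ^ n - c n‖ ^ 2) (𝓝[<] 1) (𝓝 0) := by
    have := tendsto_tsum_of_dominated_convergence (𝓕 := 𝓝[<] (1 : ℝ))
      (f := fun (ρ : ℝ) n => ‖c n * (ρ : ℂ) ^ n - c n‖ ^ 2) (g := fun _ => (0 : ℝ)) hc
      (fun n => by
        have h1 : Tendsto (fun ρ : ℝ => ‖c n * (ρ : ℂ) ^ n - c n‖ ^ 2) (𝓝[<] 1)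
            (𝓝 (‖c n * ((1 : ℝ) : ℂ) ^ n - c n‖ ^ 2)) :=
          (Continuous.tendsto (by fun_prop) _).mono_left nhdsWithin_le_nhds
        simpa using h1)
      (hnear.mono fun ρ hρ n => by
        rw [Real.norm_of_nonneg (by positivity)]; exact hb2 ρ hρ n)
    simpa using this
  rw [tendsto_iff_norm_sub_tendsto_zero]
  have hsq : Tendsto (fun ρ : ℝ => ‖∑' n, (c n * (ρ : ℂ) ^ n) • (T ^ n) (h - T (adjoint T h)) -
      ∑' n, c n • (T ^ n) (h - T (adjoint T h))‖ ^ 2) (𝓝[<] 1) (𝓝 0) := by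
    refine squeeze_zero' (Eventually.of_forall fun _ => by positivity) (hnear.mono fun ρ hρ => ?_)
      (by simpa using hlim.mul_const (‖h‖ ^ 2))
    rw [← Summable.tsum_sub (summable_smul_pow_defect hT
      (Summable.of_nonneg_of_le (fun _ => by positivity) (hb ρ hρ) hc) h)
      (summable_smul_pow_defect hT hc h)]
    simp only [← sub_smul]
    exact norm_tsum_smul_pow_defect_sq_le hT
      (Summable.of_nonneg_of_le (fun _ => by positivity) (hb2 ρ hρ) hc) h
  have := (Real.continuous_sqrt.tendsto 0).comp hsq
  simpa [Function.comp_def, Real.sqrt_sq] using this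

theorem summable_mul_pow_of_summable_sq {c : ℕ → ℂ} (hc : Summable fun n => ‖c n‖ ^ 2) {ρ : ℝ}
    (h0 : 0 ≤ ρ) (h1 : ρ < 1) : Summable fun n => ‖c n * (ρ : ℂ) ^ n‖ := by
  have hg := summable_geometric_of_lt_one (pow_nonneg h0 2) (pow_lt_one₀ h0 h1 two_ne_zero)
  refine Summable.of_nonneg_of_le (fun n => norm_nonneg _) (fun n => ?_) (hc.add hg)
  rw [norm_mul, norm_pow, Complex.norm_real, Real.norm_of_nonneg h0, ← pow_mul, mul_comm 2 n, pow_mul]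
  nlinarith [sq_nonneg (‖c n‖ - ρ ^ n), norm_nonneg (c n), pow_nonneg h0 n]

theorem summable_smul_pow_apply {T : H →L[ℂ] H} (hT : ‖T‖ ≤ 1) {a : ℕ → ℂ}
    (ha : Summable fun n => ‖a n‖) (x : H) : Summable fun n => a n • (T ^ n) x :=
  ((hasSum_smul_pow hT ha).mapL (ContinuousLinearMap.apply ℂ H x)).summable

/-! ### Invariance and density of the Abel-convergent vectors -/

theorem AbelConvergent.add {T : H →L[ℂ] H} (hT : ‖T‖ ≤ 1) {x y : H} (hx : AbelConvergent T x)
    (hy : AbelConvergent T y) : AbelConvergent T (x + y) := fun c hc => by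
  obtain ⟨u, hu⟩ := hx c hc
  obtain ⟨v, hv⟩ := hy c hc
  refine ⟨u + v, (hu.add hv).congr' ?_⟩
  filter_upwards [Ioo_mem_nhdsLT (show (0 : ℝ) < 1 by norm_num)] with ρ hρ
  have hs := summable_mul_pow_of_summable_sq hc hρ.1.le hρ.2
  rw [← (summable_smul_pow_apply hT hs x).tsum_add (summable_smul_pow_apply hT hs y)]
  simp only [map_add, smul_add]

theorem tsum_smul_pow_succ {T : H →L[ℂ] H} (hT : ‖T‖ ≤ 1) {c : ℕ → ℂ}
    (hc : Summable fun n => ‖c n‖ ^ 2) (x : H) {ρ : ℝ} (h0 : 0 ≤ ρ) (h1 : ρ < 1) :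
    ∑' n, (c n * (ρ : ℂ) ^ n) • (T ^ n) x =
      c 0 • x + (ρ : ℂ) • ∑' n, (c (n + 1) * (ρ : ℂ) ^ n) • (T ^ n) (T x) := by
  rw [(summable_smul_pow_apply hT (summable_mul_pow_of_summable_sq hc h0 h1) x).tsum_eq_zero_add,
    ← tsum_const_smul'']
  congr 1
  · simp
  · refine tsum_congr fun n => ?_
    rw [smul_smul, pow_succ T n]
    change _ = _ • (T ^ n * T) x
    congr 1
    ring

/-- Shifting the coefficients by one trades `x` for `T x` up to a factor `ρ`, which tends to one.
Dropping `c_0` gives one direction, prepending a zero the other. -/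
theorem abelConvergent_apply_iff {T : H →L[ℂ] H} (hT : ‖T‖ ≤ 1) {x : H} :
    AbelConvergent T (T x) ↔ AbelConvergent T x := by
  have hρ : Tendsto (fun ρ : ℝ => (ρ : ℂ)) (𝓝[<] 1) (𝓝 1) := by
    have := (Complex.continuous_ofReal.tendsto 1).mono_left (nhdsWithin_le_nhds (s := Set.Iio 1))
    simpa using this
  constructor
  · intro h c hc
    obtain ⟨y, hy⟩ := h (fun n => c (n + 1)) ((summable_nat_add_iff 1).2 hc)
    refine ⟨c 0 • x + (1 : ℂ) • y, ((hρ.smul hy).const_add (c 0 • x)).congr' ?_⟩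
    filter_upwards [Ioo_mem_nhdsLT (show (0 : ℝ) < 1 by norm_num)] with ρ hρ
    exact (tsum_smul_pow_succ hT hc x hρ.1.le hρ.2).symm
  · intro h c hc
    set c' : ℕ → ℂ := fun n => Nat.casesOn n 0 c
    have hc' : Summable fun n => ‖c' n‖ ^ 2 := (summable_nat_add_iff 1).1 hc
    obtain ⟨y, hy⟩ := h c' hc'
    refine ⟨(1 : ℂ)⁻¹ • y, ((hρ.inv₀ one_ne_zero).smul hy).congr' ?_⟩
    filter_upwards [Ioo_mem_nhdsLT (show (0 : ℝ) < 1 by norm_num)] with ρ hρ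
    rw [tsum_smul_pow_succ hT hc' x hρ.1.le hρ.2, show c' 0 = 0 from rfl, zero_smul, zero_add,
      inv_smul_smul₀ (by exact_mod_cast hρ.1.ne')]

theorem AbelConvergent.sub {T : H →L[ℂ] H} (hT : ‖T‖ ≤ 1) {x y : H} (hx : AbelConvergent T x)
    (hy : AbelConvergent T y) : AbelConvergent T (x - y) := by
  have := hx.add hT (hy.smul (-1))
  rwa [neg_one_smul, ← sub_eq_add_neg] at this

/-- `TT*x` is `x` minus a defect vector, and the outer `T` can be stripped off. -/
theorem AbelConvergent.adjoint_apply {T : H →L[ℂ] H} (hT : ‖T‖ ≤ 1) {x : H}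
    (hx : AbelConvergent T x) : AbelConvergent T (adjoint T x) := by
  rw [← abelConvergent_apply_iff hT]
  simpa using hx.sub hT (abelConvergent_defect hT x)

/-- `T` maps this vector to the defect vector `Th - TT*(Th)`. -/
theorem abelConvergent_adjoint_defect {T : H →L[ℂ] H} (hT : ‖T‖ ≤ 1) (h : H) :
    AbelConvergent T (h - adjoint T (T h)) := by
  rw [← abelConvergent_apply_iff hT, map_sub]
  exact abelConvergent_defect hT (T h)

/-- The subspace of vectors along which Abel means converge. -/
def abelSubmodule (T : H →L[ℂ] H) (hT : ‖T‖ ≤ 1) : Submodule ℂ H where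
  carrier := {x | AbelConvergent T x}
  add_mem' hx hy := hx.add hT hy
  zero_mem' := by simpa using (abelConvergent_defect hT 0)
  smul_mem' a _ hx := hx.smul a

theorem norm_pow_apply_eq_of_defect {T : H →L[ℂ] H} {x : H}
    (h1 : ∀ n, (T ^ n) x - adjoint T (T ((T ^ n) x)) = 0) (n : ℕ) : ‖(T ^ n) x‖ = ‖x‖ := by
  induction n with
  | zero => simp
  | succ n ih =>
    rw [← ih, pow_succ']
    change ‖T ((T ^ n) x)‖ = _
    have h2 : ‖T ((T ^ n) x)‖ ^ 2 = ‖(T ^ n) x‖ ^ 2 := by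
      rw [← inner_self_eq_norm_sq (𝕜 := ℂ), ← inner_self_eq_norm_sq (𝕜 := ℂ),
        ← ContinuousLinearMap.adjoint_inner_left, ← sub_eq_zero.1 (h1 n)]
    exact (sq_eq_sq₀ (norm_nonneg _) (norm_nonneg _)).1 h2

/-- The subspace is invariant under `T` and `T*` and contains the ranges of both defects. If `x` is
orthogonal to it, both defects vanish along the orbits of `x`, so `‖Tⁿx‖ = ‖x‖ = ‖T*ⁿx‖`, and
complete non unitarity forces `x = 0`. -/
theorem dense_abelSubmodule {T : H →L[ℂ] H} (hT : IsCNUContraction T) :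
    Dense (abelSubmodule T hT.1 : Set H) := by
  rw [Submodule.dense_iff_topologicalClosure_eq_top, Submodule.topologicalClosure_eq_top_iff,
    Submodule.eq_bot_iff]
  intro x hx
  have hpow : ∀ n y, AbelConvergent T y → AbelConvergent T ((T ^ n) y) := fun n => by
    induction n with
    | zero => intro y hy; simpa using hy
    | succ n ih => intro y hy; rw [pow_succ]; exact ih _ ((abelConvergent_apply_iff hT.1).2 hy)
  have hpow' : ∀ n y, AbelConvergent T y → AbelConvergent T ((adjoint T ^ n) y) := fun n => by
    induction n with
    | zero => intro y hy; simpa using hy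
    | succ n ih => intro y hy; rw [pow_succ]; exact ih _ (hy.adjoint_apply hT.1)
  have hdef1 : ∀ n, (T ^ n) x - adjoint T (T ((T ^ n) x)) = 0 := fun n => by
    refine ext_inner_left ℂ fun h => ?_
    have := Submodule.inner_right_of_mem_orthogonal
      (hpow' n _ (abelConvergent_adjoint_defect hT.1 h) : _ ∈ abelSubmodule T hT.1) hx
    rw [← adjoint_pow_eq, ContinuousLinearMap.adjoint_inner_left] at this
    simpa [inner_sub_left, inner_sub_right, ContinuousLinearMap.adjoint_inner_left,
      ContinuousLinearMap.adjoint_inner_right] using this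
  have hdef2 : ∀ n, (adjoint T ^ n) x - T (adjoint T ((adjoint T ^ n) x)) = 0 := fun n => by
    refine ext_inner_left ℂ fun h => ?_
    have := Submodule.inner_right_of_mem_orthogonal
      (hpow n _ (abelConvergent_defect hT.1 h) : _ ∈ abelSubmodule T hT.1) hx
    rw [← ContinuousLinearMap.adjoint_inner_right, adjoint_pow_eq] at this
    have e : ∀ w, (inner ℂ (T (adjoint T h)) w : ℂ) = inner ℂ h (T (adjoint T w)) := fun w => by
      rw [← ContinuousLinearMap.adjoint_inner_right, ContinuousLinearMap.adjoint_inner_left]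
    rw [inner_sub_left, e] at this
    rw [inner_sub_right, inner_zero_right, this]
  refine hT.2 x fun n => ⟨norm_pow_apply_eq_of_defect hdef1 n,
    norm_pow_apply_eq_of_defect (T := adjoint T) ?_ n⟩
  simpa [ContinuousLinearMap.adjoint_adjoint] using hdef2

/-- Convergence on a dense subspace together with the uniform bound of von Neumann's inequality
yields convergence everywhere. -/
theorem tendsto_hInftyCalc {T : H →L[ℂ] H} (hT : IsCNUContraction T) {f : ℂ → ℂ}
    (hf : IsHInfty f) (x : H) :
    Tendsto (fun ρ : ℝ => dilatedCalc f ρ T x) (𝓝[<] (1 : ℝ)) (𝓝 (hInftyCalc f T x)) := by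
  obtain ⟨C, hC⟩ := hf.2
  have hC0 : 0 ≤ C := (norm_nonneg _).trans (hC 0 (by simp))
  have hnear : ∀ᶠ ρ : ℝ in 𝓝[<] 1, ρ ∈ Set.Ioo (0 : ℝ) 1 := Ioo_mem_nhdsLT one_pos
  have hex : ∀ x : H, ∃ y, Tendsto (fun ρ : ℝ => dilatedCalc f ρ T x) (𝓝[<] (1 : ℝ)) (𝓝 y) := by
    intro x
    rw [← cauchy_map_iff_exists_tendsto, Metric.cauchy_iff]
    refine ⟨map_neBot, fun ε hε => ?_⟩
    obtain ⟨g, hg, hxg⟩ := Metric.dense_iff.1 (dense_abelSubmodule hT) x (ε / (4 * (C + 1)))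
      (by positivity)
    obtain ⟨y, hy⟩ := (hxg : AbelConvergent T g) (taylorCoeff f) hf.summable_norm_sq
    have hyn := Metric.tendsto_nhds.1 hy (ε / 4) (by positivity)
    refine ⟨_, image_mem_map (inter_mem hyn hnear), ?_⟩
    have hclose : ∀ ρ ∈ {ρ : ℝ | dist (∑' n, (taylorCoeff f n * (ρ : ℂ) ^ n) • (T ^ n) g) y < ε / 4} ∩
        {ρ | ρ ∈ Set.Ioo (0 : ℝ) 1}, dist (dilatedCalc f ρ T x) y < ε / 2 := by
      rintro ρ ⟨h1, h2⟩
      have h3 : dilatedCalc f ρ T g = ∑' n, (taylorCoeff f n * (ρ : ℂ) ^ n) • (T ^ n) g :=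
        (((hasSum_dilatedCalc hf hT.1 h2.1.le h2.2).mapL
          (ContinuousLinearMap.apply ℂ H g)).tsum_eq).symm
      have h4 : dist (dilatedCalc f ρ T x) (dilatedCalc f ρ T g) ≤ ε / 4 := by
        rw [dist_eq_norm, ← map_sub]
        refine ((dilatedCalc f ρ T).le_of_opNorm_le
          (norm_dilatedCalc_le hf hC hT.1 h2.1 h2.2) _).trans ?_
        rw [Metric.mem_ball, dist_comm, dist_eq_norm, lt_div_iff₀ (by positivity)] at hg
        nlinarith [norm_nonneg (x - g)]
      calc _ ≤ dist (dilatedCalc f ρ T x) (dilatedCalc f ρ T g) + dist (dilatedCalc f ρ T g) y :=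
            dist_triangle _ _ _
        _ < ε / 4 + ε / 4 := by rw [h3] at h4 ⊢; exact add_lt_add_of_le_of_lt h4 h1
        _ = ε / 2 := by ring
    rintro _ ⟨ρ, hρ, rfl⟩ _ ⟨σ, hσ, rfl⟩
    calc _ ≤ dist (dilatedCalc f ρ T x) y + dist (dilatedCalc f σ T x) y := dist_triangle_right _ _ _
      _ < ε / 2 + ε / 2 := add_lt_add (hclose ρ hρ) (hclose σ hσ)
      _ = ε := by ring
  choose A hA using hex
  -- A pointwise limit of bounded operators is bounded, so `hInftyCalc` is a genuine limit and not
  -- its default value `0`.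
  have h : ∃ A : H →L[ℂ] H, ∀ x : H,
      Tendsto (fun ρ : ℝ => dilatedCalc f ρ T x) (𝓝[<] (1 : ℝ)) (𝓝 (A x)) :=
    ⟨continuousLinearMapOfTendsto (fun ρ : ℝ => dilatedCalc f ρ T) (tendsto_pi_nhds.2 hA), hA⟩
  rw [hInftyCalc, dif_pos h]
  exact h.choose_spec x

end StrongLimit

/-! ### The absolute value of an operator -/

section OpAbs

variable {H : Type*} [NormedAddCommGroup H] [InnerProductSpace ℂ H] [CompleteSpace H]

open ContinuousLinearMap (adjoint)

theorem norm_opAbs_apply (G : H →L[ℂ] H) (x : H) : ‖opAbs G x‖ = ‖G x‖ := by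
  have h : ‖opAbs G x‖ ^ 2 = ‖G x‖ ^ 2 := by
    have hs : adjoint (opAbs G) = opAbs G :=
      (ContinuousLinearMap.isSelfAdjoint_iff'.1 (IsSelfAdjoint.of_nonneg (CFC.abs_nonneg G)))
    have hm : opAbs G * opAbs G = adjoint G * G := CFC.abs_mul_abs G
    have h1 : opAbs G (opAbs G x) = adjoint G (G x) := congrArg (fun B => B x) hm
    rw [← inner_self_eq_norm_sq (𝕜 := ℂ), ← inner_self_eq_norm_sq (𝕜 := ℂ),
      ← ContinuousLinearMap.adjoint_inner_right, hs, h1, ContinuousLinearMap.adjoint_inner_right]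
  exact (sq_eq_sq₀ (norm_nonneg _) (norm_nonneg _)).1 h

theorem exists_sqrt_opAbs (G : H →L[ℂ] H) :
    ∃ q : H →L[ℂ] H, adjoint q = q ∧ q * q = opAbs G :=
  ⟨CFC.sqrt (opAbs G), ContinuousLinearMap.isSelfAdjoint_iff'.1
    (IsSelfAdjoint.of_nonneg (CFC.sqrt_nonneg _)), CFC.sqrt_mul_sqrt_self _ (CFC.abs_nonneg G)⟩

/-- An approximate polar decomposition. -/
theorem exists_approx_polar (G : H →L[ℂ] H) {ε : ℝ} (hε : 0 < ε) :
    ∃ U : H →L[ℂ] H, ‖U‖ ≤ 1 ∧ ‖G - U * opAbs G‖ ≤ ε := by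
  set Q := opAbs G with hQ
  have h0 : 0 ≤ Q := CFC.abs_nonneg G
  have hpos : Q.IsPositive := (ContinuousLinearMap.nonneg_iff_isPositive Q).1 h0
  -- The choice `U = G(|G| + ε)⁻¹` avoids partial isometries. It is a contraction because `‖Gv‖ =
  -- ‖|G|v‖ ≤ ‖(|G| + ε)v‖`, and the error `G - U|G|` is exactly `εU`.
  set M : H →L[ℂ] H := Q + ε • (1 : H →L[ℂ] H) with hM
  have hle : ∀ y, ‖Q y‖ ≤ ‖M y‖ := fun y => by
    have e : M y = Q y + (ε : ℂ) • y := rfl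
    have h1 : ‖M y‖ ^ 2 = ‖Q y‖ ^ 2 + 2 * (ε * (inner ℂ (Q y) y : ℂ).re) + ‖(ε : ℂ) • y‖ ^ 2 := by
      rw [e, norm_add_sq (𝕜 := ℂ), inner_smul_right]
      congr 3
      simp
    have h2 : 0 ≤ (inner ℂ (Q y) y : ℂ).re := hpos.re_inner_nonneg_left y
    have h3 : 0 ≤ ε * (inner ℂ (Q y) y : ℂ).re := mul_nonneg hε.le h2
    exact le_of_sq_le_sq (by nlinarith [sq_nonneg ‖(ε : ℂ) • y‖]) (norm_nonneg _)
  have hu : IsUnit M := by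
    have hsp : IsStrictlyPositive (ε • (1 : H →L[ℂ] H)) := isStrictlyPositive_one.smul hε
    exact (hsp.nonneg_add h0).isUnit
  obtain ⟨u, hu⟩ := hu
  set R : H →L[ℂ] H := ((u⁻¹ : (H →L[ℂ] H)ˣ) : H →L[ℂ] H) with hR
  have hMR : M * R = 1 := by rw [← hu, hR]; exact u.mul_inv
  have hRM : R * M = 1 := by rw [← hu, hR]; exact u.inv_mul
  have hU : ‖G * R‖ ≤ 1 := by
    refine ContinuousLinearMap.opNorm_le_bound _ zero_le_one fun x => ?_
    change ‖G (R x)‖ ≤ _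
    rw [← norm_opAbs_apply, one_mul]
    refine (hle (R x)).trans_eq ?_
    have := congrArg (fun B : H →L[ℂ] H => B x) hMR
    exact congrArg norm this
  refine ⟨G * R, hU, ?_⟩
  have e : G - G * R * Q = ε • (G * R) := by
    have h1 : Q = M - ε • (1 : H →L[ℂ] H) := by simp [hM]
    rw [h1, mul_sub, mul_assoc, hRM, mul_one, mul_smul_comm, mul_one, sub_sub_cancel]
  rw [e, norm_smul, Real.norm_of_nonneg hε.le]
  exact mul_le_of_le_one_right hε.le hU

end OpAbs

/-! ### The canonical basis and Hilbert–Schmidt sums -/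

section TraceNorm

variable {d : ℕ}

open ContinuousLinearMap (adjoint)

theorem inner_basisVec (j : Site d) (x : Hilb d) : inner ℂ (basisVec j) x = x j := by
  rw [basisVec, lp.inner_single_left]
  simp

theorem basisVec_apply (j k : Site d) : (basisVec j : Hilb d) k = if k = j then 1 else 0 := by
  simp [basisVec, lp.single_apply, Pi.single_apply]

theorem orthonormal_basisVec : Orthonormal ℂ (basisVec : Site d → Hilb d) := by
  classical
  rw [orthonormal_iff_ite]
  intro i j
  rw [inner_basisVec, basisVec_apply]

theorem norm_basisVec (j : Site d) : ‖(basisVec j : Hilb d)‖ = 1 := orthonormal_basisVec.1 j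

theorem tsum_enorm_inner_sq (x : Hilb d) :
    ∑' j, ‖(inner ℂ (basisVec j) x : ℂ)‖ₑ ^ 2 = ‖x‖ₑ ^ 2 := by
  have h := lp.hasSum_norm (p := 2) (by norm_num) x
  simp only [ENNReal.toReal_ofNat, Real.rpow_ofNat] at h
  simp only [inner_basisVec, ← ofReal_norm, ← ENNReal.ofReal_pow (norm_nonneg _)]
  rw [← ENNReal.ofReal_tsum_of_nonneg (fun _ => by positivity) h.summable, h.tsum_eq]

/-- The square of the Hilbert–Schmidt norm. -/
noncomputable def hsSq (q : Hilb d →L[ℂ] Hilb d) : ℝ≥0∞ := ∑' j, ‖q (basisVec j)‖ₑ ^ 2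

/-- Both sides are the double sum of the squared moduli of the matrix entries. -/
theorem hsSq_adjoint (q : Hilb d →L[ℂ] Hilb d) : hsSq (adjoint q) = hsSq q := by
  simp only [hsSq, ← tsum_enorm_inner_sq]
  rw [ENNReal.tsum_comm]
  refine tsum_congr fun i => tsum_congr fun j => ?_
  rw [ContinuousLinearMap.adjoint_inner_right, ← inner_conj_symm]
  rw [← ofReal_norm, RCLike.norm_conj, ofReal_norm]

theorem hsSq_comp_le_left (C q : Hilb d →L[ℂ] Hilb d) : hsSq (C ∘L q) ≤ ‖C‖ₑ ^ 2 * hsSq q := by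
  rw [hsSq, hsSq, ← ENNReal.tsum_mul_left]
  refine ENNReal.tsum_le_tsum fun j => ?_
  rw [← mul_pow]
  gcongr
  exact C.le_opENorm _

theorem hsSq_comp_le_right (q C : Hilb d →L[ℂ] Hilb d) : hsSq (q ∘L C) ≤ ‖C‖ₑ ^ 2 * hsSq q := by
  rw [← hsSq_adjoint, ContinuousLinearMap.adjoint_comp, ← hsSq_adjoint q]
  refine (hsSq_comp_le_left _ _).trans_eq ?_
  rw [← ofReal_norm, ← ofReal_norm, LinearIsometryEquiv.norm_map]

theorem sum_norm_sq_le_hsSq {q : Hilb d →L[ℂ] Hilb d} (hq : hsSq q ≠ ⊤) (C : Hilb d →L[ℂ] Hilb d)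
    (s : Finset (Site d)) :
    ∑ j ∈ s, ‖q (C (basisVec j))‖ ^ 2 ≤ ‖C‖ ^ 2 * (hsSq q).toReal := by
  have h1 : ∑ j ∈ s, ‖(q ∘L C) (basisVec j)‖ₑ ^ 2 ≤ ‖C‖ₑ ^ 2 * hsSq q :=
    (ENNReal.sum_le_tsum s).trans (hsSq_comp_le_right q C)
  have h2 := ENNReal.toReal_mono (ENNReal.mul_ne_top (by simp) hq) h1
  rw [ENNReal.toReal_sum (fun _ _ => by simp), ENNReal.toReal_mul] at h2
  simpa using h2

/-! ### The trace norm -/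

theorem traceNorm_eq_hsSq {G q : Hilb d →L[ℂ] Hilb d} (hs : adjoint q = q)
    (hqq : q * q = opAbs G) : traceNorm G = hsSq q := by
  refine tsum_congr fun j => ?_
  rw [← hqq]
  change ENNReal.ofReal (inner ℂ _ (q (q _))).re = _
  rw [← ContinuousLinearMap.adjoint_inner_left, hs]
  rw [show (inner ℂ (q (basisVec j)) (q (basisVec j)) : ℂ).re = ‖q (basisVec j)‖ ^ 2 from
    inner_self_eq_norm_sq (𝕜 := ℂ) _, ENNReal.ofReal_pow (norm_nonneg _), ofReal_norm]

/-- Partial traces of `A G C` are bounded by `‖A‖ ‖G‖₁ ‖C‖`. -/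
theorem norm_sum_inner_comp_le {G : Hilb d →L[ℂ] Hilb d} (hG : traceNorm G ≠ ⊤)
    (A C : Hilb d →L[ℂ] Hilb d) (s : Finset (Site d)) :
    ‖∑ j ∈ s, (inner ℂ (basisVec j) (A (G (C (basisVec j)))) : ℂ)‖ ≤
      ‖A‖ * ‖C‖ * (traceNorm G).toReal := by
  obtain ⟨q, hqs, hqq⟩ := exists_sqrt_opAbs G
  have hqt := traceNorm_eq_hsSq hqs hqq
  rw [hqt] at hG ⊢
  set τ := (hsSq q).toReal with hτ
  have hτ0 : 0 ≤ τ := ENNReal.toReal_nonneg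
  -- With `|G| = q²` each term is an inner product of two vectors in the image of `q`;
  -- Cauchy–Schwarz leaves two Hilbert–Schmidt sums, each bounded through `‖q‖²_HS = ‖G‖₁`.
  have hmain : ∀ U : Hilb d →L[ℂ] Hilb d, ‖U‖ ≤ 1 →
      ‖∑ j ∈ s, (inner ℂ (basisVec j) (A (U (opAbs G (C (basisVec j))))) : ℂ)‖ ≤ ‖A‖ * ‖C‖ * τ := by
    intro U hU
    have hB : ‖adjoint (A * U)‖ ≤ ‖A‖ := by
      rw [LinearIsometryEquiv.norm_map]
      exact (norm_mul_le _ _).trans (mul_le_of_le_one_right (norm_nonneg _) hU)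
    have hterm : ∀ j, (inner ℂ (basisVec j) (A (U (opAbs G (C (basisVec j))))) : ℂ) =
        inner ℂ (q (adjoint (A * U) (basisVec j))) (q (C (basisVec j))) := fun j => by
      rw [← ContinuousLinearMap.adjoint_inner_right, hqs, ContinuousLinearMap.adjoint_inner_left,
        ← hqq]
      rfl
    have h1 : ‖∑ j ∈ s, (inner ℂ (basisVec j) (A (U (opAbs G (C (basisVec j))))) : ℂ)‖ ≤
        ∑ j ∈ s, ‖q (adjoint (A * U) (basisVec j))‖ * ‖q (C (basisVec j))‖ :=
      norm_sum_le_of_le _ fun j _ => by rw [hterm]; exact norm_inner_le_norm _ _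
    have h2 := Finset.sum_mul_sq_le_sq_mul_sq s (fun j => ‖q (adjoint (A * U) (basisVec j))‖)
      fun j => ‖q (C (basisVec j))‖
    refine h1.trans (le_of_sq_le_sq (h2.trans ?_) (by positivity))
    calc _ ≤ (‖adjoint (A * U)‖ ^ 2 * τ) * (‖C‖ ^ 2 * τ) :=
          mul_le_mul (sum_norm_sq_le_hsSq hG _ s) (sum_norm_sq_le_hsSq hG _ s)
            (Finset.sum_nonneg fun _ _ => by positivity) (by positivity)
      _ ≤ (‖A‖ ^ 2 * τ) * (‖C‖ ^ 2 * τ) := by gcongr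
      _ = _ := by ring
  -- The approximate polar decomposition costs an error proportional to `ε` and to the size of `s`;
  -- as `s` is fixed, `ε → 0` removes it.
  have hε : ∀ ε > 0, ‖∑ j ∈ s, (inner ℂ (basisVec j) (A (G (C (basisVec j)))) : ℂ)‖ ≤
      ‖A‖ * ‖C‖ * τ + s.card * (‖A‖ * ‖C‖) * ε := by
    intro ε hε
    obtain ⟨U, hU, hUG⟩ := exists_approx_polar G hε
    have e : ∑ j ∈ s, (inner ℂ (basisVec j) (A (G (C (basisVec j)))) : ℂ) =
        ∑ j ∈ s, (inner ℂ (basisVec j) (A (U (opAbs G (C (basisVec j))))) : ℂ) +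
        ∑ j ∈ s, (inner ℂ (basisVec j) (A ((G - U * opAbs G) (C (basisVec j)))) : ℂ) := by
      rw [← Finset.sum_add_distrib]
      refine Finset.sum_congr rfl fun j _ => ?_
      rw [← inner_add_right, ← map_add]
      congr 2
      simp
    rw [e]
    refine (norm_add_le _ _).trans (add_le_add (hmain U hU) ?_)
    refine (norm_sum_le_of_le s (f := fun j => (inner ℂ (basisVec j)
      (A ((G - U * opAbs G) (C (basisVec j)))) : ℂ)) (n := fun _ => ‖A‖ * ‖C‖ * ε)
      fun j _ => ?_).trans_eq ?_
    · refine (norm_inner_le_norm _ _).trans ?_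
      rw [norm_basisVec, one_mul]
      calc _ ≤ ‖A‖ * (ε * (‖C‖ * ‖(basisVec j : Hilb d)‖)) := by
            refine A.le_opNorm_of_le (ContinuousLinearMap.le_of_opNorm_le_of_le _ hUG
              (C.le_opNorm _))
        _ = _ := by rw [norm_basisVec]; ring
    · rw [Finset.sum_const, nsmul_eq_mul]; ring
  have hlim : Tendsto (fun ε : ℝ => ‖A‖ * ‖C‖ * τ + s.card * (‖A‖ * ‖C‖) * ε) (𝓝[>] 0)
      (𝓝 (‖A‖ * ‖C‖ * τ + s.card * (‖A‖ * ‖C‖) * 0)) :=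
    (Continuous.tendsto (by fun_prop) _).mono_left nhdsWithin_le_nhds
  rw [mul_zero, add_zero] at hlim
  exact ge_of_tendsto hlim (eventually_mem_nhdsWithin.mono hε)

/-! ### Finite volume traces -/

/-- The trace is the sum of the characteristic roots, and those of `A^k` are `k`-th powers of
eigenvalues of `A`. -/
theorem norm_trace_pow_le {K : Type*} [NormedAddCommGroup K] [InnerProductSpace ℂ K]
    [FiniteDimensional ℂ K] (A : K →L[ℂ] K) {r : ℝ} (hr : 0 ≤ r)
    (hA : spectralRadius ℂ A ≤ ENNReal.ofReal r) (k : ℕ) :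
    ‖LinearMap.trace ℂ K ((A ^ k : K →L[ℂ] K) : K →ₗ[ℂ] K)‖ ≤ Module.finrank ℂ K * r ^ k := by
  set B : Module.End ℂ K := (A : K →ₗ[ℂ] K) with hB
  have hpow : ((A ^ k : K →L[ℂ] K) : K →ₗ[ℂ] K) = B ^ k := ContinuousLinearMap.toLinearMap_pow A k
  have hspec : ∀ ν ∈ spectrum ℂ B, ‖ν‖ ≤ r := by
    intro ν hν
    -- The spectra in the algebras of linear and of continuous operators are compared through an
    -- eigenvector, which rules out invertibility of `ν - A`.
    have hν2 : ν ∈ spectrum ℂ A := by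
      obtain ⟨v, hv⟩ := (Module.End.hasEigenvalue_iff_mem_spectrum.2 hν).exists_hasEigenvector
      intro hu
      refine hv.2 ?_
      obtain ⟨u, hu⟩ := hu
      have h1 : (algebraMap ℂ (K →L[ℂ] K) ν - A) v = 0 := by
        have := hv.apply_eq_smul
        rw [hB] at this
        simp only [sub_apply, Algebra.algebraMap_eq_smul_one,
          smul_apply]
        rw [sub_eq_zero]
        exact this.symm
      have h2 : (u⁻¹ : (K →L[ℂ] K)ˣ).val ((algebraMap ℂ (K →L[ℂ] K) ν - A) v) = v := by
        rw [← hu]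
        exact congrArg (fun B : K →L[ℂ] K => B v) u.inv_mul
      rw [← h2, h1, map_zero]
    have h3 : (‖ν‖₊ : ℝ≥0∞) ≤ ENNReal.ofReal r :=
      (le_iSup₂ (f := fun (k : ℂ) (_ : k ∈ spectrum ℂ A) => (‖k‖₊ : ℝ≥0∞)) ν hν2).trans hA
    have h4 := ENNReal.toReal_mono ENNReal.ofReal_ne_top h3
    rwa [ENNReal.toReal_ofReal hr] at h4
  have hroot : ∀ μ ∈ (B ^ k).charpoly.roots, ‖μ‖ ≤ r ^ k := by
    intro μ hμ
    have hμ2 : μ ∈ spectrum ℂ (B ^ k) :=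
      (Module.End.mem_spectrum_iff_isRoot_charpoly _ _).2 (Polynomial.isRoot_of_mem_roots hμ)
    rcases k.eq_zero_or_pos with rfl | hk
    · rw [pow_zero] at hμ2 ⊢
      rcases subsingleton_or_nontrivial K with hK | hK
      · exact absurd (isUnit_of_subsingleton _) hμ2
      · rw [spectrum.one_eq] at hμ2
        rw [Set.mem_singleton_iff.1 hμ2, norm_one]
    · rw [spectrum.map_pow_of_pos B hk] at hμ2
      obtain ⟨ν, hν, rfl⟩ := hμ2
      simp only [norm_pow]
      exact pow_le_pow_left₀ (norm_nonneg _) (hspec ν hν) k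
  rw [hpow, Module.End.trace_eq_sum_roots_charpoly_of_splits (IsAlgClosed.splits _)]
  have h1 : ((B ^ k).charpoly.roots.map norm).sum ≤ Module.finrank ℂ K * r ^ k := by
    have := Multiset.sum_le_card_nsmul ((B ^ k).charpoly.roots.map norm) (r ^ k) (by
      intro x hx
      obtain ⟨μ, hμ, rfl⟩ := Multiset.mem_map.1 hx
      exact hroot μ hμ)
    rw [Multiset.card_map, nsmul_eq_mul] at this
    refine this.trans ?_
    gcongr
    exact (Polynomial.card_roots' _).trans_eq (LinearMap.charpoly_natDegree _)
  exact (norm_multiset_sum_le _).trans h1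

theorem exists_orthonormalBasis_volSpace (Λ : Finset (Site d)) :
    ∃ b : OrthonormalBasis Λ ℂ (volSpace Λ), ∀ j, (b j : Hilb d) = basisVec j := by
  classical
  exact ⟨OrthonormalBasis.span orthonormal_basisVec Λ, fun j =>
    OrthonormalBasis.span_apply orthonormal_basisVec Λ j⟩

/-- The projection `P` intertwines `A ⊕ C` with `A`, so `PT^k - A^kP` telescopes and `C` drops out.
Inserting `K.starProjection` makes the operator `P(T - A ⊕ C)` on the whole space appear in every
term. -/
theorem projection_comp_pow (K : Submodule ℂ (Hilb d)) [K.HasOrthogonalProjection]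
    (T : Hilb d →L[ℂ] Hilb d) (A : K →L[ℂ] K) (C : Kᗮ →L[ℂ] Kᗮ) (k : ℕ) (x : Hilb d) :
    K.orthogonalProjectionOnto ((T ^ k) x) = (A ^ k) (K.orthogonalProjectionOnto x) +
      ∑ i ∈ Finset.range k, (A ^ i) (K.orthogonalProjectionOnto
        (K.starProjection ((T - directSum K A C) ((T ^ (k - 1 - i)) x)))) := by
  induction k generalizing x with
  | zero => simp
  | succ k ih =>
    have hS : K.orthogonalProjectionOnto (directSum K A C x) =
        A (K.orthogonalProjectionOnto x) := by
      simp [directSum]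
    have hP : K.orthogonalProjectionOnto (K.starProjection ((T - directSum K A C) x)) =
        K.orthogonalProjectionOnto (T x) - A (K.orthogonalProjectionOnto x) := by
      rw [← hS, ← map_sub]
      exact Submodule.orthogonalProjectionOnto_mem_subspace_eq_self _
    have hT : (T ^ (k + 1)) x = (T ^ k) (T x) := by rw [pow_succ]; rfl
    rw [hT, ih, Finset.sum_range_succ, Nat.add_sub_cancel, Nat.sub_self, pow_zero,
      one_apply_eq_self, hP, map_sub, pow_succ A]
    change _ = (A ^ k) (A _) + (_ + (_ - (A ^ k) (A _)))
    have hsum : ∀ i ∈ Finset.range k, (T ^ (k - 1 - i)) (T x) = (T ^ (k - i)) x := fun i hi => by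
      have : k - i = (k - 1 - i) + 1 := by have := Finset.mem_range.1 hi; omega
      rw [this, pow_succ]; rfl
    rw [Finset.sum_congr rfl fun i hi => by rw [hsum i hi]]
    abel

/-- The main term is the trace of `A^k` on `K`. Each of the `k` telescoping terms costs one trace
norm, since the factors around it are contractions. -/
theorem norm_sum_inner_pow_le {Λ : Finset (Site d)} {K : Submodule ℂ (Hilb d)}
    [FiniteDimensional ℂ K] [K.HasOrthogonalProjection] (b : OrthonormalBasis Λ ℂ K)
    (hb : ∀ j, (b j : Hilb d) = basisVec j) {T : Hilb d →L[ℂ] Hilb d} (hT : ‖T‖ ≤ 1)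
    {A : K →L[ℂ] K} (hA : ‖A‖ ≤ 1) (C : Kᗮ →L[ℂ] Kᗮ)
    {r : ℝ} (hr : 0 ≤ r) (hspr : spectralRadius ℂ A ≤ ENNReal.ofReal r)
    (hF : traceNorm (K.starProjection ∘L (T - directSum K A C)) ≠ ⊤) (k : ℕ) :
    ‖∑ j ∈ Λ, (inner ℂ (basisVec j) ((T ^ k) (basisVec j)) : ℂ)‖ ≤ Λ.card * r ^ k +
      k * (traceNorm (K.starProjection ∘L (T - directSum K A C))).toReal := by
  set G := K.starProjection ∘L (T - directSum K A C) with hG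
  set P : Hilb d →L[ℂ] K := K.orthogonalProjectionOnto with hP
  have hPn : ‖P‖ ≤ 1 := K.orthogonalProjectionOnto_norm_le
  have hbP : ∀ j : Λ, P (basisVec j) = b j := fun j => by
    rw [← hb j]
    exact Submodule.orthogonalProjectionOnto_mem_subspace_eq_self (b j)
  have hterm : ∀ j ∈ Λ, (inner ℂ (basisVec j) ((T ^ k) (basisVec j)) : ℂ) =
      inner ℂ (basisVec j) (((A ^ k) (P (basisVec j)) : K) : Hilb d) +
      ∑ i ∈ Finset.range k, inner ℂ (basisVec j)
        ((K.subtypeL ∘L (A ^ i) ∘L P) (G ((T ^ (k - 1 - i)) (basisVec j)))) := by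
    intro j hj
    have h1 : (inner ℂ (basisVec j) ((T ^ k) (basisVec j)) : ℂ) =
        inner ℂ (basisVec j) ((P ((T ^ k) (basisVec j)) : K) : Hilb d) := by
      have h2 : (basisVec j : Hilb d) = (b ⟨j, hj⟩ : Hilb d) := (hb ⟨j, hj⟩).symm
      rw [h2, hP, Submodule.coe_orthogonalProjectionOnto_apply,
        ← Submodule.inner_starProjection_left_eq_right,
        Submodule.starProjection_eq_self_iff.2 (b ⟨j, hj⟩).2]
    rw [h1, projection_comp_pow K T A C k, Submodule.coe_add, inner_add_right, Submodule.coe_sum,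
      inner_sum]
    rfl
  rw [Finset.sum_congr rfl hterm, Finset.sum_add_distrib, Finset.sum_comm]
  refine (norm_add_le _ _).trans (add_le_add ?_ ?_)
  · have e : ∑ j ∈ Λ, (inner ℂ (basisVec j) (((A ^ k) (P (basisVec j)) : K) : Hilb d) : ℂ) =
        LinearMap.trace ℂ K ((A ^ k : K →L[ℂ] K) : K →ₗ[ℂ] K) := by
      rw [LinearMap.trace_eq_sum_inner _ b, ← Finset.sum_coe_sort]
      refine Finset.sum_congr rfl fun j _ => ?_
      rw [Submodule.coe_inner, hb, hbP]
      rfl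
    rw [e]
    refine (norm_trace_pow_le A hr hspr k).trans_eq ?_
    rw [Module.finrank_eq_card_basis b.toBasis, Fintype.card_coe]
  · refine (norm_sum_le_of_le _ (n := fun _ => (traceNorm G).toReal) fun i _ => ?_).trans_eq (by simp)
    refine (norm_sum_inner_comp_le hF (K.subtypeL ∘L (A ^ i) ∘L P) (T ^ (k - 1 - i)) Λ).trans ?_
    refine mul_le_of_le_one_left ENNReal.toReal_nonneg (mul_le_one₀ ?_ (norm_nonneg _)
      (norm_pow_le_one_of_norm_le_one hT _))
    refine ContinuousLinearMap.opNorm_le_bound _ zero_le_one fun x => ?_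
    change ‖(A ^ i) (P x)‖ ≤ _
    rw [one_mul]
    exact (norm_apply_le_of_norm_le_one (norm_pow_le_one_of_norm_le_one hA i) _).trans
      ((P.le_of_opNorm_le hPn x).trans_eq (one_mul _))

end TraceNorm

/-! ### Counting in boxes -/

section Lattice

variable {d : ℕ}

/-- Independence over the integers means that an integer determinant is nonzero, and it stays
nonzero over the reals. -/
theorem real_linearIndependent_of_int {γ : Fin d → Site d} (hγ : LinearIndependent ℤ γ)
    {x : Fin d → ℝ} (hx : ∀ k, ∑ i, x i * (γ i k : ℝ) = 0) : x = 0 := by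
  set M : Matrix (Fin d) (Fin d) ℤ := Matrix.of fun k i => γ i k with hM
  have hdet : M.det ≠ 0 := by
    intro h
    obtain ⟨v, hv, hv0⟩ := Matrix.exists_mulVec_eq_zero_iff.2 h
    refine hv (funext (Fintype.linearIndependent_iff.1 hγ v ?_))
    ext k
    have := congrFun hv0 k
    simp only [Matrix.mulVec, dotProduct, hM, Matrix.of_apply, Pi.zero_apply] at this
    rw [Finset.sum_apply, Pi.zero_apply, ← this]
    exact Finset.sum_congr rfl fun i _ => by simp [mul_comm]
  have hdet' : (M.map (Int.castRingHom ℝ)).det ≠ 0 := by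
    rw [← RingHom.mapMatrix_apply, ← RingHom.map_det]
    simpa using hdet
  refine Matrix.eq_zero_of_mulVec_eq_zero hdet' (funext fun k => ?_)
  simp only [Matrix.mulVec, dotProduct, hM, Matrix.map_apply, Matrix.of_apply, Pi.zero_apply]
  rw [← hx k]
  exact Finset.sum_congr rfl fun i _ => by simp [mul_comm]

theorem mem_cell {γ : Fin d → Site d} {j : Site d} : j ∈ cell γ ↔ j ∈ cellSet γ :=
  Set.Finite.mem_toFinset _

theorem zero_mem_cell (γ : Fin d → Site d) : (0 : Site d) ∈ cell γ :=
  mem_cell.2 ⟨0, by simp, by simp⟩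

/-- By real independence `m - m'` is a difference of coordinates from `[0, 1)`, hence an integer
strictly between `-1` and `1`. -/
theorem cell_add_injective {γ : Fin d → Site d} (hγ : LinearIndependent ℤ γ) {b b' : Site d}
    (hb : b ∈ cell γ) (hb' : b' ∈ cell γ) {m m' : Fin d → ℤ}
    (h : b + ∑ i, m i • γ i = b' + ∑ i, m' i • γ i) : m = m' := by
  obtain ⟨x, hx, hxb⟩ := mem_cell.1 hb
  obtain ⟨x', hx', hxb'⟩ := mem_cell.1 hb'
  have h0 := real_linearIndependent_of_int hγ (x := fun i => (x i + m i) - (x' i + m' i))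
    fun k => by
      have hk := congrFun h k
      simp only [Pi.add_apply, Finset.sum_apply, Pi.smul_apply, smul_eq_mul] at hk
      have hk' : (b k : ℝ) + ∑ i, (m i : ℝ) * γ i k = b' k + ∑ i, (m' i : ℝ) * γ i k := by
        exact_mod_cast hk
      rw [hxb, hxb'] at hk'
      simp only [sub_mul, add_mul, Finset.sum_sub_distrib, Finset.sum_add_distrib]
      linarith
  ext i
  have hi := congrFun h0 i
  simp only [Pi.zero_apply] at hi
  have h1 : ((m i - m' i : ℤ) : ℝ) < 1 := by push_cast; linarith [(hx i).1, (hx' i).2]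
  have h2 : (-1 : ℝ) < ((m i - m' i : ℤ) : ℝ) := by push_cast; linarith [(hx i).2, (hx' i).1]
  have h3 : m i - m' i < 1 := by exact_mod_cast h1
  have h4 : -1 < m i - m' i := by exact_mod_cast h2
  omega

theorem sum_box {γ : Fin d → Site d} (hγ : LinearIndependent ℤ γ) {E : Type*} [AddCommMonoid E]
    {F : Site d → E} (hF : ∀ g ∈ Submodule.span ℤ (Set.range γ), ∀ j, F (j + g) = F j) (n : ℕ) :
    ∑ j ∈ box γ n, F j = (Fintype.piFinset fun _ : Fin d => Finset.Icc (-(n : ℤ)) (n : ℤ)).card •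
      ∑ b ∈ cell γ, F b := by
  rw [box, Finset.sum_biUnion]
  · rw [← Finset.sum_const]
    refine Finset.sum_congr rfl fun m _ => ?_
    rw [Finset.sum_image (add_left_injective _).injOn]
    refine Finset.sum_congr rfl fun b _ => hF _ ?_ b
    exact Submodule.sum_mem _ fun i _ => Submodule.smul_mem _ _ (Submodule.subset_span ⟨i, rfl⟩)
  · intro m _ m' _ hne
    refine Finset.disjoint_left.2 fun j hj hj' => hne ?_
    obtain ⟨b, hb, rfl⟩ := Finset.mem_image.1 hj
    obtain ⟨b', hb', h⟩ := Finset.mem_image.1 hj'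
    exact cell_add_injective hγ hb hb' h.symm

theorem card_box {γ : Fin d → Site d} (hγ : LinearIndependent ℤ γ) (n : ℕ) :
    (box γ n).card =
      (Fintype.piFinset fun _ : Fin d => Finset.Icc (-(n : ℤ)) (n : ℤ)).card * (cell γ).card := by
  have := sum_box hγ (F := fun _ => (1 : ℕ)) (fun _ _ _ => rfl) n
  simpa using this

theorem card_cell_pos (γ : Fin d → Site d) : 0 < (cell γ).card :=
  Finset.card_pos.2 ⟨0, zero_mem_cell γ⟩

theorem card_piFinset_pos (n : ℕ) :
    0 < (Fintype.piFinset fun _ : Fin d => Finset.Icc (-(n : ℤ)) (n : ℤ)).card :=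
  Finset.card_pos.2 ⟨0, by simp⟩

theorem card_box_pos {γ : Fin d → Site d} (hγ : LinearIndependent ℤ γ) (n : ℕ) :
    0 < (box γ n).card := by
  rw [card_box hγ]
  exact Nat.mul_pos (card_piFinset_pos n) (card_cell_pos γ)

end Lattice

/-! ### Random operators -/

section Random

variable {d : ℕ} {X : Set ℝ}

theorem hasSum_inner_apply_basisVec (A : Hilb d →L[ℂ] Hilb d) (x u : Hilb d) :
    HasSum (fun j => inner ℂ x (A (basisVec j)) * inner ℂ (basisVec j) u) (inner ℂ x (A u)) := by
  have h1 : HasSum (fun j : Site d => u j • (basisVec j : Hilb d)) u := by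
    have := lp.hasSum_single (p := 2) (by norm_num) u
    convert this using 2 with j
    rw [basisVec, ← lp.single_smul, smul_eq_mul, mul_one]
  have h2 := (h1.mapL A).mapL (innerSL ℂ x)
  simp only [map_smul, innerSL_apply_apply, smul_eq_mul] at h2
  simpa only [inner_basisVec, mul_comm] using h2

/-- Inserting the basis between `T` and `T^k` writes the matrix element as a pointwise limit of
finite sums of products of measurable ones. -/
theorem measurable_inner_pow {α : Type*} [MeasurableSpace α] {T : α → (Hilb d →L[ℂ] Hilb d)}
    (hT : ∀ x y : Hilb d, Measurable fun ω => (inner ℂ x (T ω y) : ℂ)) (k : ℕ) (x y : Hilb d) :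
    Measurable fun ω => (inner ℂ x ((T ω ^ k) y) : ℂ) := by
  induction k generalizing x with
  | zero => simp
  | succ k ih =>
    refine measurable_of_tendsto_metrizable' (atTop : Filter (Finset (Site d)))
      (f := fun s ω => ∑ j ∈ s, inner ℂ x (T ω (basisVec j)) *
        (inner ℂ (basisVec j) ((T ω ^ k) y) : ℂ)) (fun s => ?_) (tendsto_pi_nhds.2 fun ω => ?_)
    · exact Finset.measurable_fun_sum _ fun j _ => (hT x _).mul (ih _)
    · rw [pow_succ']
      exact hasSum_inner_apply_basisVec (T ω) x ((T ω ^ k) y)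

theorem measurePreserving_shift (μ : Measure X) [IsProbabilityMeasure μ] (g : Site d) :
    MeasurePreserving (shift g) (prodMeasure d μ) (prodMeasure d μ) := by
  refine ⟨measurable_pi_lambda _ fun k => measurable_pi_apply _, ?_⟩
  -- The shift is reindexing along `k ↦ k - g`, which preserves a product of identical factors.
  have := Measure.infinitePi_map_piCongrLeft (fun _ : Site d => μ) (Equiv.subRight g)
  convert this using 2
  ext ω k
  rw [MeasurableEquiv.coe_piCongrLeft]
  have h := Equiv.piCongrLeft_apply_apply (fun _ : Site d => X) (Equiv.subRight g) ω (k + g)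
  have e : Equiv.subRight g (k + g) = k := add_sub_cancel_right k g
  rw [e] at h
  rw [h]
  rfl

theorem translate_symm_basisVec (g j : Site d) :
    (translate g).symm (basisVec j) = basisVec (j + g) := by
  rw [LinearIsometryEquiv.symm_apply_eq, translate_basisVec, add_sub_cancel_right]

theorem conj_translate_pow (g : Site d) (A : Hilb d →L[ℂ] Hilb d) (k : ℕ) (x : Hilb d) :
    ((((translate g).toContinuousLinearEquiv : Hilb d →L[ℂ] Hilb d) ∘L A ∘L
      ((translate g).symm.toContinuousLinearEquiv : Hilb d →L[ℂ] Hilb d)) ^ k) x =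
        translate g ((A ^ k) ((translate g).symm x)) := by
  induction k with
  | zero => simp
  | succ k ih =>
    rw [pow_succ', pow_succ' A]
    exact (congrArg (fun v => translate g (A ((translate g).symm v))) ih).trans (by simp)

/-! ### Moments of the density of states -/

variable {μ : Measure X} [IsProbabilityMeasure μ] {γ : Fin d → Site d}
  {T : Config d X → (Hilb d →L[ℂ] Hilb d)}

/-- By covariance the left integrand at `ω` is the right integrand at `shift g ω`, and the shift
preserves the measure. -/
theorem integral_inner_pow_add
    (hTmeas : ∀ x y : Hilb d, Measurable fun ω => (inner ℂ x (T ω y) : ℂ))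
    (hTerg : ∀ g ∈ Submodule.span ℤ (Set.range γ), ∀ ω,
      T (shift g ω) =
        ((translate g).toContinuousLinearEquiv : Hilb d →L[ℂ] Hilb d) ∘L T ω ∘L
          ((translate g).symm.toContinuousLinearEquiv : Hilb d →L[ℂ] Hilb d))
    (k : ℕ) {g : Site d} (hg : g ∈ Submodule.span ℤ (Set.range γ)) (j : Site d) :
    ∫ ω, (inner ℂ (basisVec (j + g)) ((T ω ^ k) (basisVec (j + g))) : ℂ) ∂(prodMeasure d μ) =
      ∫ ω, (inner ℂ (basisVec j) ((T ω ^ k) (basisVec j)) : ℂ) ∂(prodMeasure d μ) := by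
  have hm := measurable_inner_pow hTmeas k (basisVec j) (basisVec j)
  have hs := measurePreserving_shift (d := d) μ g
  conv_rhs => rw [← hs.map_eq, integral_map hs.measurable.aemeasurable hm.aestronglyMeasurable]
  refine integral_congr_ae (ae_of_all _ fun ω => ?_)
  simp only
  rw [hTerg g hg ω, conj_translate_pow, translate_symm_basisVec, ← translate_symm_basisVec,
    ← LinearIsometryEquiv.inner_map_map (translate g), LinearIsometryEquiv.apply_symm_apply]

/-- The moments of the density of states functional. -/
noncomputable def dosMoment (γ : Fin d → Site d) (μ : Measure X) [IsProbabilityMeasure μ]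
    (T : Config d X → (Hilb d →L[ℂ] Hilb d)) (k : ℕ) : ℂ :=
  ((cell γ).card : ℂ)⁻¹ *
    ∑ b ∈ cell γ, ∫ ω, inner ℂ (basisVec b) ((T ω ^ k) (basisVec b)) ∂(prodMeasure d μ)

theorem norm_inner_pow_le_one (hT : ∀ ω, ‖T ω‖ ≤ 1) (k : ℕ) (j : Site d) (ω : Config d X) :
    ‖(inner ℂ (basisVec j) ((T ω ^ k) (basisVec j)) : ℂ)‖ ≤ 1 := by
  refine (norm_inner_le_norm _ _).trans ?_
  have := norm_apply_le_of_norm_le_one (norm_pow_le_one_of_norm_le_one (hT ω) k) (basisVec j)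
  rw [norm_basisVec] at this ⊢
  rwa [one_mul]

theorem integrable_inner_pow
    (hTmeas : ∀ x y : Hilb d, Measurable fun ω => (inner ℂ x (T ω y) : ℂ))
    (hT : ∀ ω, ‖T ω‖ ≤ 1) (k : ℕ) (j : Site d) :
    Integrable (fun ω => (inner ℂ (basisVec j) ((T ω ^ k) (basisVec j)) : ℂ)) (prodMeasure d μ) :=
  Integrable.of_bound (measurable_inner_pow hTmeas k _ _).aestronglyMeasurable 1
    (ae_of_all _ fun ω => norm_inner_pow_le_one hT k j ω)

/-- The moments are expectations of normalized traces over the boxes. -/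
theorem dosMoment_eq_integral (hγ : LinearIndependent ℤ γ)
    (hTmeas : ∀ x y : Hilb d, Measurable fun ω => (inner ℂ x (T ω y) : ℂ))
    (hT : ∀ ω, ‖T ω‖ ≤ 1)
    (hTerg : ∀ g ∈ Submodule.span ℤ (Set.range γ), ∀ ω,
      T (shift g ω) =
        ((translate g).toContinuousLinearEquiv : Hilb d →L[ℂ] Hilb d) ∘L T ω ∘L
          ((translate g).symm.toContinuousLinearEquiv : Hilb d →L[ℂ] Hilb d))
    (k n : ℕ) :
    dosMoment γ μ T k = ∫ ω, ((box γ n).card : ℂ)⁻¹ *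
      ∑ j ∈ box γ n, inner ℂ (basisVec j) ((T ω ^ k) (basisVec j)) ∂(prodMeasure d μ) := by
  rw [integral_const_mul, integral_finsetSum _ fun j _ => integrable_inner_pow hTmeas hT k j,
    sum_box hγ (fun g hg j => integral_inner_pow_add hTmeas hTerg k hg j) n, card_box hγ,
    nsmul_eq_mul, dosMoment]
  have h1 : ((Fintype.piFinset fun _ : Fin d => Finset.Icc (-(n : ℤ)) (n : ℤ)).card : ℂ) ≠ 0 := by
    exact_mod_cast (card_piFinset_pos n).ne'
  push_cast
  rw [mul_inv, mul_mul_mul_comm, ← mul_assoc, inv_mul_cancel₀ h1, one_mul]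

theorem dosMoment_zero : dosMoment γ μ T 0 = 1 := by
  have h1 : ((cell γ).card : ℂ) ≠ 0 := by exact_mod_cast (card_cell_pos γ).ne'
  have h2 : ∀ b : Site d, (inner ℂ (basisVec b) (basisVec b) : ℂ) = 1 := fun b => by
    rw [inner_basisVec, basisVec_apply, if_pos rfl]
  simp only [dosMoment, pow_zero, one_apply_eq_self, h2, integral_const, probReal_univ, one_smul,
    Finset.sum_const, nsmul_eq_mul, mul_one]
  exact inv_mul_cancel₀ h1

/-- The moments decay geometrically. -/
theorem norm_dosMoment_le (hγ : LinearIndependent ℤ γ)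
    (hTmeas : ∀ x y : Hilb d, Measurable fun ω => (inner ℂ x (T ω y) : ℂ))
    (hT : ∀ ω, ‖T ω‖ ≤ 1)
    (hTerg : ∀ g ∈ Submodule.span ℤ (Set.range γ), ∀ ω,
      T (shift g ω) =
        ((translate g).toContinuousLinearEquiv : Hilb d →L[ℂ] Hilb d) ∘L T ω ∘L
          ((translate g).symm.toContinuousLinearEquiv : Hilb d →L[ℂ] Hilb d))
    {TΛ : ∀ n : ℕ, Config d X → (volSpace (box γ n) →L[ℂ] volSpace (box γ n))}
    {TΛc : ∀ n : ℕ, Config d X → ((volSpace (box γ n))ᗮ →L[ℂ] (volSpace (box γ n))ᗮ)}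
    (hTΛ : ∀ n ω, ‖TΛ n ω‖ ≤ 1)
    (hPF : ∀ ω, Tendsto
      (fun n : ℕ => traceNorm ((volSpace (box γ n)).starProjection ∘L
        (T ω - directSum (volSpace (box γ n)) (TΛ n ω) (TΛc n ω))) / ((box γ n).card : ℝ≥0∞))
      atTop (𝓝 0))
    {r : ℝ} (hr : 0 ≤ r) (hspr : ∀ n ω, spectralRadius ℂ (TΛ n ω) ≤ ENNReal.ofReal r) (k : ℕ) :
    ‖dosMoment γ μ T k‖ ≤ r ^ k := by
  set Y : ℕ → Config d X → ℂ := fun n ω => ((box γ n).card : ℂ)⁻¹ *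
    ∑ j ∈ box γ n, inner ℂ (basisVec j) ((T ω ^ k) (basisVec j)) with hY
  have hcard : ∀ n, (0 : ℝ) < (box γ n).card := fun n => by exact_mod_cast card_box_pos hγ n
  have hYm : ∀ n, Measurable (Y n) := fun n =>
    measurable_const.mul (Finset.measurable_fun_sum _ fun j _ => measurable_inner_pow hTmeas k _ _)
  have hY1 : ∀ n ω, ‖Y n ω‖ ≤ 1 := fun n ω => by
    rw [hY]
    simp only
    rw [norm_mul, norm_inv, Complex.norm_natCast, inv_mul_le_one₀ (hcard n)]
    exact (norm_sum_le_of_le _ (n := fun _ => 1) fun j _ => norm_inner_pow_le_one hT k j ω).trans_eq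
      (by simp)
  -- The traces satisfy only an asymptotic upper bound. The maximum with `r^k` turns it into a
  -- limit, to which dominated convergence applies.
  have hlim : ∀ ω, Tendsto (fun n => max ‖Y n ω‖ (r ^ k)) atTop (𝓝 (r ^ k)) := by
    intro ω
    set t : ℕ → ℝ≥0∞ := fun n => traceNorm ((volSpace (box γ n)).starProjection ∘L
        (T ω - directSum (volSpace (box γ n)) (TΛ n ω) (TΛc n ω))) with ht
    have h1 : Tendsto (fun n => (t n / ((box γ n).card : ℝ≥0∞)).toReal) atTop (𝓝 0) := by
      have := (ENNReal.tendsto_toReal ENNReal.zero_ne_top).comp (hPF ω)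
      rw [ENNReal.toReal_zero] at this
      exact this
    have h2 : Tendsto (fun n => r ^ k + k * (t n / ((box γ n).card : ℝ≥0∞)).toReal) atTop
        (𝓝 (r ^ k)) := by
      simpa using (h1.const_mul (k : ℝ)).const_add (r ^ k)
    refine tendsto_of_tendsto_of_tendsto_of_le_of_le' tendsto_const_nhds h2
      (Eventually.of_forall fun n => le_max_right _ _) ?_
    filter_upwards [(hPF ω).eventually_lt_const (u := 1) (by norm_num)] with n hn
    refine max_le ?_ (le_add_of_nonneg_right (by positivity))
    -- Once the ratio is below one the trace norm is finite, so `toReal` does not hide an infinite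
    -- value.
    have htop : t n ≠ ⊤ := fun htop => by
      have : t n / ((box γ n).card : ℝ≥0∞) < 1 := hn
      rw [htop, ENNReal.top_div_of_ne_top (ENNReal.natCast_ne_top _)] at this
      exact absurd this (by simp)
    obtain ⟨b, hb⟩ := exists_orthonormalBasis_volSpace (box γ n)
    have h3 := norm_sum_inner_pow_le b hb (hT ω) (hTΛ n ω) (TΛc n ω) hr (hspr n ω) htop k
    change _ ≤ _ + k * (t n).toReal at h3
    rw [hY]
    simp only
    rw [norm_mul, norm_inv, Complex.norm_natCast, ENNReal.toReal_div, ENNReal.toReal_natCast,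
      inv_mul_le_iff₀ (hcard n)]
    refine h3.trans_eq ?_
    have := (hcard n).ne'
    field_simp
  have hle : ∀ n, ‖dosMoment γ μ T k‖ ≤ ∫ ω, max ‖Y n ω‖ (r ^ k) ∂(prodMeasure d μ) := fun n => by
    rw [dosMoment_eq_integral hγ hTmeas hT hTerg k n]
    refine (norm_integral_le_integral_norm _).trans (integral_mono_of_nonneg
      (ae_of_all _ fun ω => norm_nonneg _) ?_ (ae_of_all _ fun ω => le_max_left _ _))
    refine Integrable.of_bound ((hYm n).norm.max measurable_const).aestronglyMeasurable
      (max 1 (r ^ k)) (ae_of_all _ fun ω => ?_)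
    rw [Real.norm_of_nonneg (le_max_of_le_left (norm_nonneg _))]
    exact max_le_max_right _ (hY1 n ω)
  have hconv : Tendsto (fun n => ∫ ω, max ‖Y n ω‖ (r ^ k) ∂(prodMeasure d μ)) atTop
      (𝓝 (∫ _ω, r ^ k ∂(prodMeasure d μ))) := by
    refine tendsto_integral_filter_of_norm_le_const (Eventually.of_forall fun n =>
      ((hYm n).norm.max measurable_const).aestronglyMeasurable) ⟨max 1 (r ^ k),
      Eventually.of_forall fun n => ae_of_all _ fun ω => ?_⟩ (ae_of_all _ hlim)
    rw [Real.norm_of_nonneg (le_max_of_le_left (norm_nonneg _))]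
    exact max_le_max_right _ (hY1 n ω)
  have := ge_of_tendsto' hconv hle
  simpa using this

end Random

/-! ### The representing function -/

theorem differentiableOn_tsum_mul_pow {b : ℕ → ℂ} {r : ℝ} (hr0 : 0 ≤ r) (hr1 : r < 1)
    (hb : ∀ k, ‖b k‖ ≤ r ^ k) :
    DifferentiableOn ℂ (fun z => ∑' k, b k * z ^ k) {z : ℂ | r * ‖z‖ < 1} := by
  intro z hz
  have hz1 : r * ‖z‖ < 1 := hz
  -- A radius beyond `‖z‖` with `rR < 1`, chosen without dividing by `r` so that `r = 0` is
  -- included.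
  set R := ‖z‖ + (1 - r * ‖z‖) / 2 with hR
  have hzR : ‖z‖ < R := by rw [hR]; linarith
  have hR0 : 0 ≤ R := (norm_nonneg z).trans hzR.le
  have hrR : r * R < 1 := by rw [hR]; nlinarith
  have hd : DifferentiableOn ℂ (fun z => ∑' k, b k * z ^ k) (Metric.ball 0 R) := by
    refine Complex.differentiableOn_tsum_of_summable_norm
      (summable_geometric_of_lt_one (mul_nonneg hr0 hR0) hrR) (fun k => by fun_prop)
      Metric.isOpen_ball fun k w hw => ?_
    rw [norm_mul, norm_pow, mul_pow]
    have hw' : ‖w‖ ≤ R := (mem_ball_zero_iff.1 hw).le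
    exact mul_le_mul (hb k) (pow_le_pow_left₀ (norm_nonneg _) hw' k) (by positivity) (by positivity)
  exact (hd.differentiableAt (Metric.isOpen_ball.mem_nhds (by simpa using hzR))).differentiableWithinAt

/-! ### The density of states functional -/

section Functional

variable {d : ℕ} {X : Set ℝ} {μ : Measure X} [IsProbabilityMeasure μ] {γ : Fin d → Site d}
  {T : Config d X → (Hilb d →L[ℂ] Hilb d)}

theorem hasSum_inner_dilatedCalc {H : Type*} [NormedAddCommGroup H] [InnerProductSpace ℂ H]
    [CompleteSpace H] {f : ℂ → ℂ} (hf : IsHInfty f) {A : H →L[ℂ] H} (hA : ‖A‖ ≤ 1) {ρ : ℝ}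
    (h0 : 0 ≤ ρ) (h1 : ρ < 1) (x y : H) :
    HasSum (fun n => taylorCoeff f n * (ρ : ℂ) ^ n * inner ℂ x ((A ^ n) y))
      (inner ℂ x (dilatedCalc f ρ A y)) := by
  have := ((hasSum_dilatedCalc hf hA h0 h1).mapL (ContinuousLinearMap.apply ℂ H y)).mapL (innerSL ℂ x)
  simpa [inner_smul_right] using this

theorem measurable_inner_dilatedCalc
    (hTmeas : ∀ x y : Hilb d, Measurable fun ω => (inner ℂ x (T ω y) : ℂ))
    (hT : ∀ ω, ‖T ω‖ ≤ 1) {f : ℂ → ℂ} (hf : IsHInfty f) {ρ : ℝ} (h0 : 0 ≤ ρ) (h1 : ρ < 1)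
    (x y : Hilb d) : Measurable fun ω => (inner ℂ x (dilatedCalc f ρ (T ω) y) : ℂ) := by
  refine measurable_of_tendsto_metrizable' (atTop : Filter (Finset ℕ))
    (f := fun s ω => ∑ n ∈ s, taylorCoeff f n * (ρ : ℂ) ^ n * (inner ℂ x ((T ω ^ n) y) : ℂ))
    (fun s => ?_) (tendsto_pi_nhds.2 fun ω => hasSum_inner_dilatedCalc hf (hT ω) h0 h1 x y)
  exact Finset.measurable_fun_sum _ fun n _ => (measurable_inner_pow hTmeas n x y).const_mul _

theorem hasSum_dosMoment
    (hTmeas : ∀ x y : Hilb d, Measurable fun ω => (inner ℂ x (T ω y) : ℂ))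
    (hT : ∀ ω, ‖T ω‖ ≤ 1) {f : ℂ → ℂ} (hf : IsHInfty f) {ρ : ℝ} (h0 : 0 ≤ ρ) (h1 : ρ < 1) :
    HasSum (fun k => taylorCoeff f k * (ρ : ℂ) ^ k * dosMoment γ μ T k)
      (((cell γ).card : ℂ)⁻¹ * ∑ b ∈ cell γ,
        ∫ ω, inner ℂ (basisVec b) (dilatedCalc f ρ (T ω) (basisVec b)) ∂(prodMeasure d μ)) := by
  have hb : ∀ b : Site d, HasSum (fun k => taylorCoeff f k * (ρ : ℂ) ^ k *
      ∫ ω, inner ℂ (basisVec b) ((T ω ^ k) (basisVec b)) ∂(prodMeasure d μ))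
      (∫ ω, inner ℂ (basisVec b) (dilatedCalc f ρ (T ω) (basisVec b)) ∂(prodMeasure d μ)) := by
    intro b
    have := hasSum_integral_of_summable_integral_norm (μ := prodMeasure d μ)
      (F := fun k ω => taylorCoeff f k * (ρ : ℂ) ^ k *
        inner ℂ (basisVec b) ((T ω ^ k) (basisVec b)))
      (fun k => (integrable_inner_pow hTmeas hT k b).const_mul _) (by
        refine Summable.of_nonneg_of_le (fun k => integral_nonneg fun ω => norm_nonneg _)
          (fun k => ?_) (hf.summable_norm_mul_pow h0 h1)
        refine (integral_mono_of_nonneg (ae_of_all _ fun ω => norm_nonneg _)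
          (integrable_const (‖taylorCoeff f k * (ρ : ℂ) ^ k‖)) (ae_of_all _ fun ω => ?_)).trans_eq
          (by simp)
        simp only [norm_mul]
        exact mul_le_of_le_one_right (by positivity) (norm_inner_pow_le_one hT k b ω))
    simpa only [integral_const_mul,
      fun ω => (hasSum_inner_dilatedCalc hf (hT ω) h0 h1 (basisVec b) (basisVec b)).tsum_eq] using this
  refine ((hasSum_sum fun b _ => hb b).mul_left _).congr_fun fun k => ?_
  rw [dosMoment, ← Finset.mul_sum]
  ring

/-- Dominated convergence: von Neumann's inequality supplies the constant majorant, the strong limit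
the pointwise convergence. -/
theorem tendsto_dosFunctional
    (hTmeas : ∀ x y : Hilb d, Measurable fun ω => (inner ℂ x (T ω y) : ℂ))
    (hT : ∀ ω, IsCNUContraction (T ω)) {f : ℂ → ℂ} (hf : IsHInfty f) :
    Tendsto (fun ρ : ℝ => ((cell γ).card : ℂ)⁻¹ * ∑ b ∈ cell γ,
        ∫ ω, inner ℂ (basisVec b) (dilatedCalc f ρ (T ω) (basisVec b)) ∂(prodMeasure d μ))
      (𝓝[<] 1) (𝓝 (dosFunctional γ μ T f)) := by
  obtain ⟨C, hC⟩ := hf.2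
  have hnear : ∀ᶠ ρ : ℝ in 𝓝[<] 1, ρ ∈ Set.Ioo (0 : ℝ) 1 := Ioo_mem_nhdsLT one_pos
  refine (tendsto_finsetSum _ fun b _ => ?_).const_mul _
  refine tendsto_integral_filter_of_norm_le_const (hnear.mono fun ρ hρ =>
    (measurable_inner_dilatedCalc hTmeas (fun ω => (hT ω).1) hf hρ.1.le hρ.2 _ _).aestronglyMeasurable)
    ⟨C, hnear.mono fun ρ hρ => ae_of_all _ fun ω => ?_⟩ (ae_of_all _ fun ω => ?_)
  · refine (norm_inner_le_norm _ _).trans ?_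
    have := (dilatedCalc f ρ (T ω)).le_of_opNorm_le
      (norm_dilatedCalc_le hf hC (hT ω).1 hρ.1 hρ.2) (basisVec b)
    rw [norm_basisVec] at this ⊢
    linarith
  · exact Tendsto.inner tendsto_const_nhds (tendsto_hInftyCalc (hT ω) hf (basisVec b))

/-- Fatou's theorem gives the pointwise limit, the supremum bound on `f` the majorant. -/
theorem tendsto_integral_boundaryValue {f : ℂ → ℂ} (hf : IsHInfty f) {g : ℝ → ℂ}
    (hg : Continuous g) :
    Tendsto (fun ρ : ℝ => ∫ t in (0 : ℝ)..(2 * Real.pi),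
        f (ρ * Complex.exp (t * Complex.I)) * g t)
      (𝓝[<] 1) (𝓝 (∫ t in (0 : ℝ)..(2 * Real.pi), boundaryValue f t * g t)) := by
  obtain ⟨C, hC⟩ := hf.2
  have hnear : ∀ᶠ ρ : ℝ in 𝓝[<] 1, ρ ∈ Set.Ioo (0 : ℝ) 1 := Ioo_mem_nhdsLT one_pos
  have hmem : ∀ ρ ∈ Set.Ioo (0 : ℝ) 1, ∀ t : ℝ,
      (ρ : ℂ) * Complex.exp (t * Complex.I) ∈ Metric.ball (0 : ℂ) 1 := fun ρ hρ t => by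
    simpa [abs_of_pos hρ.1] using hρ.2
  refine intervalIntegral.tendsto_integral_filter_of_dominated_convergence (fun t => C * ‖g t‖)
    (hnear.mono fun ρ hρ => ?_) (hnear.mono fun ρ hρ => ae_of_all _ fun t _ => ?_)
    (Continuous.intervalIntegrable (by fun_prop) _ _) ?_
  · have hc : Continuous fun t : ℝ => f (ρ * Complex.exp (t * Complex.I)) :=
      hf.1.continuousOn.comp_continuous (by fun_prop) (hmem ρ hρ)
    exact (hc.mul hg).aestronglyMeasurable
  · rw [norm_mul]
    exact mul_le_mul_of_nonneg_right (hC _ (hmem ρ hρ t)) (norm_nonneg _)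
  · filter_upwards [hf.ae_tendsto_boundaryValue] with t ht _
    exact ht.mul_const _

end Functional

end DOS

theorem mainTheorem5 {d : ℕ} {X : Set ℝ} (μ : MeasureTheory.Measure X)
    [MeasureTheory.IsProbabilityMeasure μ]
    -- the generators of the periodic lattice `Γ`
    (γ : Fin d → DOS.Site d) (hγ : LinearIndependent ℤ γ)
    -- a measurable random completely non unitary contraction
    (T : DOS.Config d X → (DOS.Hilb d →L[ℂ] DOS.Hilb d))
    (hTmeas : ∀ x y : DOS.Hilb d, Measurable fun ω => (inner ℂ x (T ω y) : ℂ))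
    (hTcnu : ∀ ω, DOS.IsCNUContraction (T ω))
    -- ergodicity: `T_{S_g ω} = V_g T_ω V_g⁻¹` for all `g ∈ Γ`
    (hTerg : ∀ g ∈ Submodule.span ℤ (Set.range γ), ∀ ω,
      T (DOS.shift g ω) =
        ((DOS.translate g).toContinuousLinearEquiv : DOS.Hilb d →L[ℂ] DOS.Hilb d) ∘L T ω ∘L
          ((DOS.translate g).symm.toContinuousLinearEquiv : DOS.Hilb d →L[ℂ] DOS.Hilb d))
    -- the finite volume restrictions `T^Λ` and the operators `T^{Λᶜ}`, for `Λ = Λ_n`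
    (TΛ : ∀ n : ℕ, DOS.Config d X →
      (DOS.volSpace (DOS.box γ n) →L[ℂ] DOS.volSpace (DOS.box γ n)))
    (TΛc : ∀ n : ℕ, DOS.Config d X →
      ((DOS.volSpace (DOS.box γ n))ᗮ →L[ℂ] (DOS.volSpace (DOS.box γ n))ᗮ))
    (hTΛcnu : ∀ n ω, DOS.IsCNUContraction (TΛ n ω))
    -- `F^Λ = T - T^Λ ⊕ T^{Λᶜ}` is of trace class
    (hF : ∀ n ω, DOS.traceNorm
      (T ω - DOS.directSum (DOS.volSpace (DOS.box γ n)) (TΛ n ω) (TΛc n ω)) ≠ ⊤)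
    -- `‖P_Λ (T - T^Λ ⊕ T^{Λᶜ})‖₁ = o(|Λ|)`
    (hPF : ∀ ω, Filter.Tendsto
      (fun n : ℕ => DOS.traceNorm ((DOS.volSpace (DOS.box γ n)).starProjection ∘L
        (T ω - DOS.directSum (DOS.volSpace (DOS.box γ n)) (TΛ n ω) (TΛc n ω))) /
          ((DOS.box γ n).card : ENNReal))
      Filter.atTop (nhds 0))
    -- the uniform bound on the spectral radii
    (r : ℝ) (hr0 : 0 ≤ r) (hr1 : r < 1)
    (hspr : ∀ n ω, spectralRadius ℂ (TΛ n ω) ≤ ENNReal.ofReal r) :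
    ∃ ψ : ℂ → ℂ, DifferentiableOn ℂ ψ {z : ℂ | r * ‖z‖ < 1} ∧
      DOS.IsL1Circle (fun t : ℝ => (starRingEnd ℂ) (ψ (Complex.exp (t * Complex.I)))) ∧
      ¬ DOS.IsH10Circle (fun t : ℝ => (starRingEnd ℂ) (ψ (Complex.exp (t * Complex.I)))) ∧
      ∀ f : ℂ → ℂ, DOS.IsHInfty f →
        DOS.dosFunctional γ μ T f =
          (2 * Real.pi : ℂ)⁻¹ * ∫ t in (0 : ℝ)..(2 * Real.pi),
            DOS.boundaryValue f t * (starRingEnd ℂ) (ψ (Complex.exp (t * Complex.I))) := by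
  have hT : ∀ ω, ‖T ω‖ ≤ 1 := fun ω => (hTcnu ω).1
  set b : ℕ → ℂ := fun k => (starRingEnd ℂ) (DOS.dosMoment γ μ T k) with hb
  have hbr : ∀ k, ‖b k‖ ≤ r ^ k := fun k => by
    rw [hb, RCLike.norm_conj]
    exact DOS.norm_dosMoment_le hγ hTmeas hT hTerg (fun n ω => (hTΛcnu n ω).1) hPF hr0 hspr k
  have hbs : Summable fun k => ‖b k‖ :=
    Summable.of_nonneg_of_le (fun _ => norm_nonneg _) hbr (summable_geometric_of_lt_one hr0 hr1)
  have hcont : Continuous fun t : ℝ =>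
      (starRingEnd ℂ) (∑' k, b k * Complex.exp (t * Complex.I) ^ k) :=
    Complex.continuous_conj.comp (DOS.continuous_tsum_circle hbs)
  have hpi : (2 * Real.pi : ℂ) ≠ 0 := by simp [Real.pi_ne_zero]
  refine ⟨fun z => ∑' k, b k * z ^ k, DOS.differentiableOn_tsum_mul_pow hr0 hr1 hbr,
    hcont.intervalIntegrable _ _, fun h => ?_, fun f hf => ?_⟩
  -- Index zero suffices: the integral of `conj ψ` over the circle is `2π` times `m_0 = 1`, while
  -- membership in `H¹₀` would make it vanish.
  · have h0 := h.2 0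
    have h1 := DOS.integral_tsum_circle_mul_conj_pow hbs 0
    simp only [Nat.cast_zero, zero_mul, Complex.exp_zero, one_mul] at h0
    simp only [pow_zero, mul_one] at h1
    rw [intervalIntegral.integral_of_le Real.two_pi_pos.le, integral_conj,
      ← intervalIntegral.integral_of_le Real.two_pi_pos.le, h1, show b 0 = 1 by simp [hb, DOS.dosMoment_zero]] at h0
    simp [Real.pi_ne_zero] at h0
  · have hlim := (DOS.tendsto_integral_boundaryValue hf hcont).const_mul (2 * Real.pi : ℂ)⁻¹
    -- Both sides are limits of quantities which agree for every `ρ < 1`: one is the moment series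
    -- of the dilate, the other its Parseval sum against `ψ`.
    refine tendsto_nhds_unique (DOS.tendsto_dosFunctional hTmeas hTcnu hf) (hlim.congr' ?_)
    filter_upwards [Ioo_mem_nhdsLT (show (0 : ℝ) < 1 by norm_num)] with ρ hρ
    have h1 := DOS.integral_tsum_circle_mul_conj (hf.summable_norm_mul_pow hρ.1.le hρ.2) hbs
    simp only [hf.tsum_circle hρ.1.le hρ.2] at h1
    refine (HasSum.unique (DOS.hasSum_dosMoment hTmeas hT hf hρ.1.le hρ.2) ?_).symm
    refine (h1.mul_left (2 * Real.pi : ℂ)⁻¹).congr_fun fun k => ?_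
    rw [inv_mul_cancel_left₀ hpi, hb]
    simp
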